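/- Let $n\ge 1$, $0<p<\infty$ and $0<r\le p$. A cube is a compact cube in $\mathbb R^n$ with sides parallel to the coordinate axes; $c(Q)$, $\ell(Q)$, $|Q|$ denote the centre, side-length and volume of a cube $Q$. For $\phi:\mathbb R^n\times(0,\infty)\to(0,\infty)$ and measurable $g$ put $$\|g\|_{\mathcal M_{p,\phi}}=\sup_{Q}\frac1{\phi(c(Q),\ell(Q))}\Big(\frac1{|Q|}\int_Q|g(y)|^p\,dy\Big)^{1/p},\qquad \|g\|_{W\mathcal M_{p,\phi}}=\sup_{T>0}T\,\|\chi_{\{|g|>T\}}\|_{\mathcal M_{p,\phi}},$$ the supremum being taken over all cubes $Q$; $\mathcal M_{p,\phi}(\mathbb R^n)$ consists of all measurable $g$ with $\|g\|_{\mathcal M_{p,\phi}}<\infty$. Let $\phi_1,\phi_2:\mathbb R^n\times(0,\infty)\to(0,\infty)$ be such that for some constant $A$ and all $x\in\mathbb R^n$, $t>0$, $$\sup_{\tau>t}\Big[\Big(\inf_{\tau<s<\infty}\phi_1(x,s)^r s^{nr/p}\Big)\tau^{-nr/p}\Big]\le A\,\phi_2(x,t)^r$$ (equivalently, $\sup_{\tau>t}\inf_{s>\tau}\phi_1(x,s)s^{n/p}\tau^{-n/p}\le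 A^{1/r}\phi_2(x,t)$). Let $d\ge0$. Then there is a constant $C$, depending only on $n,p,r,\phi_1,\phi_2$ and $d$, such that for every compact set $\Omega\subset\mathbb R^n$ of diameter $d$ and every $f\in\mathcal M_{p,\phi_1}(\mathbb R^n)$ which is a tempered distribution with $\operatorname{supp}\mathcal Ff\subset\Omega$ (and is taken to be the continuous function representing it) the following hold. (1) If $r<p$, then $$\Big\|\sup_{y\in\mathbb R^n}\frac{|f(\cdot-y)|}{1+d|y|^{n/r}}\Big\|_{\mathcal M_{p,\phi_2}}\le C\,\|f\|_{\mathcal M_{p,\phi_1}}.$$ (2) If $p=r$, then $$\Big\|\sup_{y\in\mathbb R^n}\frac{|f(\cdot-y)|}{1+d|y|^{n/r}}\Big\|_{W\mathcal M_{r,\phi_2}}\le C\,\|f\|_{\mathcal M_{r,\phi_1}}.$$ -/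

import Mathlib

open scoped NNReal ENNReal SchwartzMap FourierTransform
open MeasureTheory

noncomputable section

namespace GenMorrey

/-- The Euclidean space `ℝⁿ`. -/
abbrev Rn (n : ℕ) := EuclideanSpace ℝ (Fin n)

/-- The compact cube with centre `x`, side-length `ℓ` and sides parallel to the axes. -/
def cube {n : ℕ} (x : Rn n) (ℓ : ℝ) : Set (Rn n) :=
  {y | ∀ i, |y i - x i| ≤ ℓ / 2}

/-- The generalized Morrey (quasi-)norm of a function with values in `[0, ∞]`: the supremum over
all cubes `Q`, with centre `x` and side-length `ℓ > 0`, of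
`φ(x, ℓ)⁻¹ (|Q|⁻¹ ∫_Q g ^ p) ^ (1 / p)`. -/
def morreyNorm {n : ℕ} (p : ℝ) (φ : Rn n → ℝ → ℝ) (g : Rn n → ℝ≥0∞) : ℝ≥0∞ :=
  ⨆ (x : Rn n) (ℓ : ℝ) (_ : 0 < ℓ),
    (ENNReal.ofReal (φ x ℓ))⁻¹ *
      ((volume (cube x ℓ))⁻¹ * ∫⁻ y in cube x ℓ, g y ^ p) ^ (1 / p)

/-- The weak generalized Morrey (quasi-)norm `sup_{T > 0} T ‖χ_{g > T}‖_{M_{p,φ}}`. -/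
def weakMorreyNorm {n : ℕ} (p : ℝ) (φ : Rn n → ℝ → ℝ) (g : Rn n → ℝ≥0∞) : ℝ≥0∞ :=
  ⨆ (T : ℝ) (_ : 0 < T),
    ENNReal.ofReal T *
      morreyNorm p φ (Set.indicator {x | ENNReal.ofReal T < g x} (fun _ => 1))

/-- Membership of a complex-valued function in the generalized Morrey space `M_{p,φ}(ℝⁿ)`. -/
def MemMorrey {n : ℕ} (p : ℝ) (φ : Rn n → ℝ → ℝ) (f : Rn n → ℂ) : Prop :=
  AEStronglyMeasurable f volume ∧ morreyNorm p φ (fun x => ‖f x‖ₑ) < ∞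

/-- The supremal condition on the pair `(φ₁, φ₂)`, with a constant independent of `x` and `t`:
`sup_{τ > t} [(inf_{s > τ} φ₁(x,s)^r s^{nr/p}) τ^{-nr/p}] ≤ A φ₂(x,t)^r`. -/
def SupremalCondition {n : ℕ} (p r : ℝ) (φ₁ φ₂ : Rn n → ℝ → ℝ) : Prop :=
  ∃ A : ℝ≥0, ∀ (x : Rn n) (t : ℝ), 0 < t →
    (⨆ (τ : ℝ) (_ : t < τ),
      (⨅ (s : ℝ) (_ : τ < s), ENNReal.ofReal (φ₁ x s ^ r * s ^ ((n : ℝ) * r / p))) *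
        ENNReal.ofReal (τ ^ (-((n : ℝ) * r / p))))
      ≤ A * ENNReal.ofReal (φ₂ x t ^ r)

/-- The tempered distribution `T` is the function `f`: `T ψ = ∫ ψ f`, absolutely convergent, for
all Schwartz functions `ψ`. -/
def IsGivenBy {n : ℕ} (T : 𝓢'(Rn n, ℂ)) (f : Rn n → ℂ) : Prop :=
  ∀ ψ : 𝓢(Rn n, ℂ), Integrable (fun x => ψ x * f x) ∧ T ψ = ∫ x, ψ x * f x

/-- `f` is a continuous function which is a tempered distribution with `supp 𝓕 f ⊆ Ω`.
(A tempered distribution whose Fourier transform has compact support is a smooth function of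
polynomial growth; continuity selects that pointwise representative.) -/
def IsBandLimited {n : ℕ} (Ω : Set (Rn n)) (f : Rn n → ℂ) : Prop :=
  Continuous f ∧ ∃ T : 𝓢'(Rn n, ℂ), IsGivenBy T f ∧ Distribution.dsupport (𝓕 T : 𝓢'(Rn n, ℂ)) ⊆ Ω

/-- The Peetre maximal function `x ↦ sup_y |f(x - y)| / (1 + d |y|^{n/r})`, in `[0, ∞]`. -/
def peetreMaximal {n : ℕ} (d r : ℝ) (f : Rn n → ℂ) (x : Rn n) : ℝ≥0∞ :=
  ⨆ y : Rn n, ENNReal.ofReal (‖f (x - y)‖ / (1 + d * ‖y‖ ^ ((n : ℝ) / r)))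

end GenMorrey

end

/-!
Multiplying `f` by Fourier transforms of bump functions makes it integrable while moving its
spectrum only slightly, so a reproducing formula dominates `|f|` by its convolution with a kernel of
arbitrarily fast decay at the scale `1 / δ`, where `δ` is the size of `Ω`. The Strömberg–Torchinsky
argument improves this to a pointwise bound for `|f| ^ r` for every `r > 0`, namely
`|f z| ^ r ≤ C (1 + δ |z - x|) ^ n M(|f| ^ r)(x)` with the Hardy–Littlewood maximal function `M` and
`C` independent of `δ`. Hence the Peetre maximal function is at most a constant times
`M(|f| ^ r) ^ (1 / r)`.

On a cube `Q` this is estimated by splitting `|f| ^ r` into its restriction to `5Q`, to which the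
weak (1, 1) or the strong (p / r, p / r) inequality for `M` applies, and a remainder that only sees
averages over cubes larger than `Q`. The supremal condition bounds precisely these averages by
`φ₂ (c(Q), ℓ(Q))`.
-/

noncomputable section

namespace GenMorrey

open Metric Set Filter Topology

section MaximalFunction

variable {X : Type*} [PseudoMetricSpace X] [MeasurableSpace X] {μ : Measure X} {u v : X → ℝ≥0∞}
  {x : X} {T K : ℝ≥0∞}

/-- The uncentred Hardy–Littlewood maximal function: the supremum of the averages of `u` over the
balls containing a given point. -/
def maximalFn (μ : Measure X) (u : X → ℝ≥0∞) (x : X) : ℝ≥0∞ :=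
  ⨆ (c : X) (ρ : ℝ) (_ : x ∈ ball c ρ), ⨍⁻ y in ball c ρ, u y ∂μ

lemma lt_maximalFn_iff :
    T < maximalFn μ u x ↔ ∃ c ρ, x ∈ ball c ρ ∧ T < ⨍⁻ y in ball c ρ, u y ∂μ := by
  simp only [maximalFn, lt_iSup_iff, exists_prop]

lemma setLAverage_ball_le_maximalFn {c : X} {ρ : ℝ} (hx : x ∈ ball c ρ) :
    ⨍⁻ y in ball c ρ, u y ∂μ ≤ maximalFn μ u x :=
  le_iSup₂_of_le c ρ <| le_iSup_of_le hx le_rfl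

lemma maximalFn_le_iff :
    maximalFn μ u x ≤ T ↔ ∀ c ρ, x ∈ ball c ρ → ⨍⁻ y in ball c ρ, u y ∂μ ≤ T := by
  simp only [maximalFn, iSup_le_iff]

lemma maximalFn_mono (h : u ≤ v) (x : X) : maximalFn μ u x ≤ maximalFn μ v x :=
  maximalFn_le_iff.2 fun _ _ hx =>
    (laverage_mono_ae (.of_forall h)).trans (setLAverage_ball_le_maximalFn hx)

lemma isOpen_lt_maximalFn (μ : Measure X) (u : X → ℝ≥0∞) (T : ℝ≥0∞) :
    IsOpen {x | T < maximalFn μ u x} := by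
  refine isOpen_iff_mem_nhds.2 fun x hx => ?_
  obtain ⟨c, ρ, hxc, hT⟩ := lt_maximalFn_iff.1 hx
  filter_upwards [isOpen_ball.mem_nhds hxc] with z hz
  exact lt_maximalFn_iff.2 ⟨c, ρ, hz, hT⟩

lemma measurable_maximalFn [OpensMeasurableSpace X] (μ : Measure X) (u : X → ℝ≥0∞) :
    Measurable (maximalFn μ u) :=
  measurable_of_Ioi fun T => (isOpen_lt_maximalFn μ u T).measurableSet

lemma laverage_const_le {α : Type*} [MeasurableSpace α] (ν : Measure α) (T : ℝ≥0∞) :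
    ⨍⁻ _, T ∂ν ≤ T := by
  rw [laverage_eq, lintegral_const, mul_div_assoc]
  exact mul_le_of_le_one_right' ENNReal.div_self_le_one

lemma maximalFn_const_le (T : ℝ≥0∞) (x : X) : maximalFn μ (fun _ => T) x ≤ T :=
  maximalFn_le_iff.2 fun _ _ _ => laverage_const_le _ T

lemma maximalFn_add_const_le (u : X → ℝ≥0∞) (T : ℝ≥0∞) (x : X) :
    maximalFn μ (fun y => T + u y) x ≤ T + maximalFn μ u x := by
  refine maximalFn_le_iff.2 fun c ρ hx => ?_
  calc ⨍⁻ y in ball c ρ, (T + u y) ∂μ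
      = ⨍⁻ _ in ball c ρ, T ∂μ + ⨍⁻ y in ball c ρ, u y ∂μ :=
        lintegral_add_left measurable_const _
    _ ≤ T + maximalFn μ u x :=
        add_le_add (laverage_const_le _ T) (setLAverage_ball_le_maximalFn hx)

lemma maximalFn_le_add_indicator (u : X → ℝ≥0∞) (T : ℝ≥0∞) (x : X) :
    maximalFn μ u x ≤ T + maximalFn μ ({y | T < u y}.indicator u) x := by
  refine (maximalFn_mono (fun y => ?_) x).trans (maximalFn_add_const_le _ T x)
  by_cases hy : T < u y
  · simp [indicator_of_mem (s := {y | T < u y}) hy]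
  · exact (not_lt.1 hy).trans le_self_add

variable [OpensMeasurableSpace X] [SecondCountableTopology X]

lemma mul_measure_lt_setLAverage_ball_le (hK : ∀ c ρ, μ (ball c (5 * ρ)) ≤ K * μ (ball c ρ))
    (u : X → ℝ≥0∞) (T : ℝ≥0∞) (R : ℝ) :
    T * μ {x | ∃ c ρ, ρ ≤ R ∧ x ∈ ball c ρ ∧ T < ⨍⁻ y in ball c ρ, u y ∂μ} ≤
      K * ∫⁻ y, u y ∂μ := by
  set t : Set (X × ℝ) := {a | 0 < a.2 ∧ a.2 ≤ R ∧ T < ⨍⁻ y in ball a.1 a.2, u y ∂μ}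
  obtain ⟨b, hbt, hbd, hcov⟩ := Vitali.exists_disjoint_subfamily_covering_enlargement_ball t
    Prod.fst Prod.snd R (fun a ha => ha.2.1) 5 (by norm_num)
  have hb : b.Countable := hbd.countable_of_isOpen (fun _ _ => isOpen_ball)
    fun a ha => ⟨a.1, mem_ball_self (hbt ha).1⟩
  have hsub : {x | ∃ c ρ, ρ ≤ R ∧ x ∈ ball c ρ ∧ T < ⨍⁻ y in ball c ρ, u y ∂μ} ⊆
      ⋃ a ∈ b, ball a.1 (5 * a.2) := by
    rintro x ⟨c, ρ, hρ, hx, hT⟩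
    obtain ⟨a, ha, has⟩ := hcov (c, ρ) ⟨pos_of_mem_ball hx, hρ, hT⟩
    exact mem_biUnion ha (has hx)
  have hball : ∀ a ∈ b, T * μ (ball a.1 (5 * a.2)) ≤ K * ∫⁻ y in ball a.1 a.2, u y ∂μ := by
    intro a ha
    have hT := (hbt ha).2.2.le
    rw [setLAverage_eq] at hT
    calc T * μ (ball a.1 (5 * a.2)) ≤ T * (K * μ (ball a.1 a.2)) := by gcongr; exact hK _ _
      _ = K * (T * μ (ball a.1 a.2)) := mul_left_comm _ _ _
      _ ≤ K * ∫⁻ y in ball a.1 a.2, u y ∂μ := by gcongr; exact ENNReal.mul_le_of_le_div hT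
  calc T * μ {x | ∃ c ρ, ρ ≤ R ∧ x ∈ ball c ρ ∧ T < ⨍⁻ y in ball c ρ, u y ∂μ}
      ≤ T * ∑' a : b, μ (ball a.1.1 (5 * a.1.2)) := by
        gcongr
        exact (measure_mono hsub).trans (measure_biUnion_le _ hb _)
    _ = ∑' a : b, T * μ (ball a.1.1 (5 * a.1.2)) := ENNReal.tsum_mul_left.symm
    _ ≤ ∑' a : b, K * ∫⁻ y in ball a.1.1 a.1.2, u y ∂μ :=
        ENNReal.tsum_le_tsum fun a => hball a.1 a.2
    _ = K * ∫⁻ y in ⋃ a ∈ b, ball a.1 a.2, u y ∂μ := by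
        rw [ENNReal.tsum_mul_left, lintegral_biUnion hb (fun _ _ => measurableSet_ball) hbd]
    _ ≤ K * ∫⁻ y, u y ∂μ := by gcongr; exact Measure.restrict_le_self

lemma mul_measure_lt_maximalFn_le (hK : ∀ c ρ, μ (ball c (5 * ρ)) ≤ K * μ (ball c ρ))
    (u : X → ℝ≥0∞) (T : ℝ≥0∞) :
    T * μ {x | T < maximalFn μ u x} ≤ K * ∫⁻ y, u y ∂μ := by
  set U : ℕ → Set X := fun R =>
    {x | ∃ (c : X) (ρ : ℝ), ρ ≤ R ∧ x ∈ ball c ρ ∧ T < ⨍⁻ y in ball c ρ, u y ∂μ} with hU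
  have hmono : Monotone U := fun R R' hR x ⟨c, ρ, hρ, hx⟩ =>
    ⟨c, ρ, hρ.trans (Nat.cast_le.2 hR), hx⟩
  have hunion : {x | T < maximalFn μ u x} = ⋃ R, U R := by
    ext x
    simp only [hU, mem_iUnion, mem_ofPred_eq, lt_maximalFn_iff]
    constructor
    · rintro ⟨c, ρ, hx⟩
      obtain ⟨R, hR⟩ := exists_nat_ge ρ
      exact ⟨R, c, ρ, hR, hx⟩
    · rintro ⟨-, c, ρ, -, hx⟩
      exact ⟨c, ρ, hx⟩
  rw [hunion, hmono.measure_iUnion, ENNReal.mul_iSup]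
  exact iSup_le fun R => mul_measure_lt_setLAverage_ball_le hK u T R

lemma mul_measure_two_mul_lt_maximalFn_le
    (hK : ∀ c ρ, μ (ball c (5 * ρ)) ≤ K * μ (ball c ρ)) (u : X → ℝ≥0∞) (T : ℝ≥0∞) :
    T * μ {x | 2 * T < maximalFn μ u x} ≤ K * ∫⁻ y in {y | T < u y}, u y ∂μ := by
  have hsub : {x | 2 * T < maximalFn μ u x} ⊆
      {x | T < maximalFn μ ({y | T < u y}.indicator u) x} := fun x hx => by
    by_contra! h
    refine (lt_self_iff_false (2 * T)).1 (lt_of_lt_of_le hx ?_)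
    rw [two_mul]
    exact (maximalFn_le_add_indicator u T x).trans (by gcongr; exact not_lt.1 h)
  calc T * μ {x | 2 * T < maximalFn μ u x}
      ≤ T * μ {x | T < maximalFn μ ({y | T < u y}.indicator u) x} := by gcongr
    _ ≤ K * ∫⁻ y, {y | T < u y}.indicator u y ∂μ := mul_measure_lt_maximalFn_le hK _ T
    _ ≤ K * ∫⁻ y in {y | T < u y}, u y ∂μ := mul_le_mul_right (lintegral_indicator_le _ _) K

end MaximalFunction

section LayerCake

variable {α : Type*} [MeasurableSpace α] {μ : Measure α} {u : α → ℝ≥0∞} {q : ℝ}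

lemma setLIntegral_Ioi_ofReal_rpow (s : ℝ) : ∫⁻ t in Ioi (0 : ℝ), ENNReal.ofReal (t ^ s) = ∞ := by
  by_contra h
  refine not_integrableOn_Ioi_rpow s ((lintegral_ofReal_ne_top_iff_integrable ?_ ?_).1 h)
  · exact (by fun_prop : Measurable fun t : ℝ => t ^ s).aestronglyMeasurable
  · filter_upwards [self_mem_ae_restrict measurableSet_Ioi] with t ht
    exact Real.rpow_nonneg (le_of_lt ht) s

lemma lintegral_rpow_eq_lintegral_measure_mul (hu : AEMeasurable u μ) (hq : 0 < q) :
    ∫⁻ x, u x ^ q ∂μ = ENNReal.ofReal q *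
      ∫⁻ t in Ioi (0 : ℝ), μ {x | ENNReal.ofReal t < u x} * ENNReal.ofReal (t ^ (q - 1)) := by
  by_cases htop : μ {x | u x = ∞} = 0
  · have hfin : ∀ᵐ x ∂μ, u x ≠ ∞ := measure_eq_zero_iff_ae_notMem.1 htop
    have hcake := lintegral_rpow_eq_lintegral_meas_lt_mul (μ := μ) (f := fun x => (u x).toReal)
      (.of_forall fun _ => ENNReal.toReal_nonneg) hu.ennreal_toReal hq
    have hpow : ∫⁻ x, u x ^ q ∂μ = ∫⁻ x, ENNReal.ofReal ((u x).toReal ^ q) ∂μ := by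
      refine lintegral_congr_ae (hfin.mono fun x hx => ?_)
      beta_reduce
      rw [← ENNReal.ofReal_rpow_of_nonneg ENNReal.toReal_nonneg hq.le, ENNReal.ofReal_toReal hx]
    rw [hpow, hcake]
    congr 1
    refine setLIntegral_congr_fun measurableSet_Ioi fun t ht => ?_
    congr 1
    refine measure_congr (hfin.mono fun x hx => propext ?_)
    exact (ENNReal.ofReal_lt_iff_lt_toReal (le_of_lt ht) hx).symm
  · have hpow : μ {x | u x ^ q = ∞} ≠ 0 := by simpa [ENNReal.rpow_eq_top_iff_of_pos hq] using htop
    rw [lintegral_eq_top_of_measure_eq_top_ne_zero (hu.pow_const q) hpow, eq_comm, eq_top_iff]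
    calc ∞ = ENNReal.ofReal q *
          ∫⁻ t in Ioi (0 : ℝ), μ {x | u x = ∞} * ENNReal.ofReal (t ^ (q - 1)) := by
          rw [lintegral_const_mul _ (by fun_prop), setLIntegral_Ioi_ofReal_rpow,
            ENNReal.mul_top htop, ENNReal.mul_top (by simpa using hq)]
      _ ≤ _ := by
          gcongr with t x
          rintro (hx : u x = ∞)
          simp [hx]

lemma lintegral_rpow_sub_one_withDensity (hu : Measurable u) (hq : 1 ≤ q) :
    ∫⁻ x, u x ^ (q - 1) ∂μ.withDensity u = ∫⁻ x, u x ^ q ∂μ := by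
  rw [lintegral_withDensity_eq_lintegral_mul _ hu (hu.pow_const _)]
  refine lintegral_congr fun x => ?_
  calc u x * u x ^ (q - 1) = u x ^ (1 : ℝ) * u x ^ (q - 1) := by rw [ENNReal.rpow_one]
    _ = u x ^ q := by
      rw [← ENNReal.rpow_add_of_nonneg _ _ zero_le_one (sub_nonneg.2 hq), add_sub_cancel]

end LayerCake

section StrongType

variable {X : Type*} [PseudoMetricSpace X] [MeasurableSpace X] [OpensMeasurableSpace X]
  [SecondCountableTopology X] {μ : Measure X} {u : X → ℝ≥0∞} {K : ℝ≥0∞} {q : ℝ}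

lemma lintegral_measure_two_mul_lt_maximalFn_le
    (hK : ∀ c ρ, μ (ball c (5 * ρ)) ≤ K * μ (ball c ρ)) (hq : 1 < q) (hu : Measurable u) :
    ∫⁻ t in Ioi (0 : ℝ), μ {x | 2 * ENNReal.ofReal t < maximalFn μ u x} *
      ENNReal.ofReal (t ^ (q - 1)) ≤ K * (ENNReal.ofReal (q - 1)⁻¹ * ∫⁻ x, u x ^ q ∂μ) := by
  have hq' : 0 < q - 1 := sub_pos.2 hq
  have hweak : ∀ t ∈ Ioi (0 : ℝ), μ {x | 2 * ENNReal.ofReal t < maximalFn μ u x} *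
      ENNReal.ofReal (t ^ (q - 1)) ≤
      K * (μ.withDensity u {x | ENNReal.ofReal t < u x} * ENNReal.ofReal (t ^ (q - 1 - 1))) := by
    intro t ht
    have htq : t ^ (q - 1) = t * t ^ (q - 1 - 1) := by
      rw [← Real.rpow_one_add' (le_of_lt ht) (by linarith), add_sub_cancel]
    rw [withDensity_apply _ (measurableSet_lt measurable_const hu), htq,
      ENNReal.ofReal_mul (le_of_lt ht), ← mul_assoc, ← mul_assoc, mul_comm (μ _)]
    exact mul_le_mul_left (mul_measure_two_mul_lt_maximalFn_le hK u _) _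
  calc _ ≤ ∫⁻ t in Ioi (0 : ℝ), K * (μ.withDensity u {x | ENNReal.ofReal t < u x} *
          ENNReal.ofReal (t ^ (q - 1 - 1))) := setLIntegral_mono' measurableSet_Ioi hweak
    _ = K * ∫⁻ t in Ioi (0 : ℝ), μ.withDensity u {x | ENNReal.ofReal t < u x} *
          ENNReal.ofReal (t ^ (q - 1 - 1)) := by
        refine lintegral_const_mul _ (Measurable.mul ?_ (by fun_prop))
        exact Antitone.measurable fun s t hst => measure_mono fun x hx =>
          (ENNReal.ofReal_le_ofReal hst).trans_lt hx
    _ = K * (ENNReal.ofReal (q - 1)⁻¹ * ∫⁻ x, u x ^ q ∂μ) := by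
        rw [← lintegral_rpow_sub_one_withDensity hu hq.le,
          lintegral_rpow_eq_lintegral_measure_mul hu.aemeasurable hq',
          ← mul_assoc (ENNReal.ofReal _), ← ENNReal.ofReal_mul (inv_nonneg.2 hq'.le),
          inv_mul_cancel₀ hq'.ne', ENNReal.ofReal_one, one_mul]

/-- Integrate the weak type inequality for the truncations of `u` over the levels. -/
lemma lintegral_maximalFn_rpow_le (hK : ∀ c ρ, μ (ball c (5 * ρ)) ≤ K * μ (ball c ρ))
    (hq : 1 < q) (hu : Measurable u) :
    ∫⁻ x, maximalFn μ u x ^ q ∂μ ≤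
      2 ^ q * (ENNReal.ofReal q * (K * ENNReal.ofReal (q - 1)⁻¹)) * ∫⁻ x, u x ^ q ∂μ := by
  have hq0 : 0 < q := by linarith
  have hhalf : ∀ x, maximalFn μ u x = 2 * (maximalFn μ u x / 2) := fun x =>
    (ENNReal.mul_div_cancel two_ne_zero ENNReal.ofNat_ne_top).symm
  have hlevel : ∀ t x, ENNReal.ofReal t < maximalFn μ u x / 2 ↔
      2 * ENNReal.ofReal t < maximalFn μ u x := fun t x => by
    rw [ENNReal.lt_div_iff_mul_lt (.inl two_ne_zero) (.inl ENNReal.ofNat_ne_top), mul_comm]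
  calc ∫⁻ x, maximalFn μ u x ^ q ∂μ = 2 ^ q * ∫⁻ x, (maximalFn μ u x / 2) ^ q ∂μ := by
        rw [← lintegral_const_mul' _ _ (by finiteness)]
        refine lintegral_congr fun x => ?_
        rw [← ENNReal.mul_rpow_of_nonneg _ _ hq0.le, ← hhalf]
    _ = 2 ^ q * (ENNReal.ofReal q * ∫⁻ t in Ioi (0 : ℝ),
          μ {x | 2 * ENNReal.ofReal t < maximalFn μ u x} * ENNReal.ofReal (t ^ (q - 1))) := by
        rw [lintegral_rpow_eq_lintegral_measure_mul
          ((measurable_maximalFn μ u).div_const 2).aemeasurable hq0]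
        simp only [hlevel]
    _ ≤ 2 ^ q * (ENNReal.ofReal q * (K * (ENNReal.ofReal (q - 1)⁻¹ * ∫⁻ x, u x ^ q ∂μ))) := by
        gcongr
        exact lintegral_measure_two_mul_lt_maximalFn_le hK hq hu
    _ = _ := by ring

end StrongType

section PolyDecay

variable {X : Type*} [PseudoMetricSpace X] {δ a b : ℝ}

/-- The weight `(1 + δ |z - w|)^{-a}`, decaying polynomially at scale `δ⁻¹`; unlike a bump function
it is submultiplicative, see `polyDecay_mul_polyDecay_le`. -/
def polyDecay (δ a : ℝ) (z w : X) : ℝ≥0∞ := ENNReal.ofReal ((1 + δ * dist z w) ^ (-a))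

lemma one_le_one_add_mul_dist (hδ : 0 ≤ δ) (z w : X) : 1 ≤ 1 + δ * dist z w :=
  le_add_of_nonneg_right (mul_nonneg hδ dist_nonneg)

@[fun_prop]
lemma measurable_polyDecay [MeasurableSpace X] [OpensMeasurableSpace X] (δ a : ℝ) (z : X) :
    Measurable (polyDecay δ a z) := by
  have hdist : Measurable fun w => dist z w := (by fun_prop : Continuous _).measurable
  unfold polyDecay
  fun_prop

@[simp]
lemma polyDecay_self (δ a : ℝ) (z : X) : polyDecay δ a z z = 1 := by simp [polyDecay]

lemma polyDecay_anti (hδ : 0 ≤ δ) (hab : a ≤ b) (z w : X) :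
    polyDecay δ b z w ≤ polyDecay δ a z w :=
  ENNReal.ofReal_le_ofReal <| Real.rpow_le_rpow_of_exponent_le (one_le_one_add_mul_dist hδ z w)
    (neg_le_neg hab)

lemma polyDecay_le_one (hδ : 0 ≤ δ) (ha : 0 ≤ a) (z w : X) : polyDecay δ a z w ≤ 1 := by
  simpa [polyDecay] using polyDecay_anti hδ ha z w

lemma polyDecay_rpow (hδ : 0 ≤ δ) {r : ℝ} (hr : 0 ≤ r) (a : ℝ) (z w : X) :
    polyDecay δ a z w ^ r = polyDecay δ (a * r) z w := by
  have h := zero_le_one.trans (one_le_one_add_mul_dist hδ z w)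
  rw [polyDecay, ENNReal.ofReal_rpow_of_nonneg (Real.rpow_nonneg h _) hr, ← Real.rpow_mul h,
    neg_mul, polyDecay]

lemma polyDecay_mul_polyDecay_le (hδ : 0 ≤ δ) (ha : 0 ≤ a) (z v w : X) :
    polyDecay δ a z v * polyDecay δ a v w ≤ polyDecay δ a z w := by
  have hzv := one_le_one_add_mul_dist hδ z v
  have hvw := one_le_one_add_mul_dist hδ v w
  have hzw := one_le_one_add_mul_dist hδ z w
  have hsubmul : 1 + δ * dist z w ≤ (1 + δ * dist z v) * (1 + δ * dist v w) := by
    nlinarith [mul_le_mul_of_nonneg_left (dist_triangle z v w) hδ,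
      mul_nonneg (mul_nonneg hδ (dist_nonneg (x := z) (y := v)))
        (mul_nonneg hδ (dist_nonneg (x := v) (y := w)))]
  rw [polyDecay, polyDecay, ← ENNReal.ofReal_mul (Real.rpow_nonneg (by linarith) _),
    ← Real.mul_rpow (by linarith) (by linarith)]
  exact ENNReal.ofReal_le_ofReal <|
    Real.rpow_le_rpow_of_nonpos (by linarith) hsubmul (neg_nonpos.2 ha)

lemma polyDecay_le_tsum_indicator_ball (hδ : 0 < δ) (ha : 0 ≤ a) (z w : X) :
    polyDecay δ a z w ≤ ∑' k : ℕ, (ball z (2 ^ (k + 1) / δ)).indicator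
      (fun _ => ENNReal.ofReal ((2 ^ k) ^ (-a))) w := by
  obtain ⟨k, hk, hk'⟩ := exists_nat_pow_near (one_le_one_add_mul_dist hδ.le z w) one_lt_two
  refine le_trans ?_ (ENNReal.le_tsum k)
  have hw : w ∈ ball z (2 ^ (k + 1) / δ) := by
    rw [mem_ball', lt_div_iff₀ hδ, mul_comm]
    linarith
  rw [indicator_of_mem hw]
  exact ENNReal.ofReal_le_ofReal <|
    Real.rpow_le_rpow_of_nonpos (by positivity) hk (neg_nonpos.2 ha)

end PolyDecay

section Domination

open Module

variable {E : Type*} [NormedAddCommGroup E] [NormedSpace ℝ E] [FiniteDimensional ℝ E]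
  [MeasurableSpace E] [BorelSpace E] {μ : Measure E} [μ.IsAddHaarMeasure] {u : E → ℝ≥0∞} {δ : ℝ}

lemma addHaar_ball_five_mul (c : E) (ρ : ℝ) :
    μ (ball c (5 * ρ)) ≤ 5 ^ finrank ℝ E * μ (ball c ρ) := by
  rw [Measure.addHaar_ball_mul_of_pos _ _ (by norm_num), Measure.addHaar_ball_center,
    ENNReal.ofReal_pow (by norm_num), ENNReal.ofReal_ofNat, Measure.addHaar_ball_center μ c]

lemma setLIntegral_ball_le_maximalFn (u : E → ℝ≥0∞) {x c : E} {ρ : ℝ} (hx : x ∈ ball c ρ) :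
    ∫⁻ y in ball c ρ, u y ∂μ ≤
      ENNReal.ofReal (ρ ^ finrank ℝ E) * μ (ball 0 1) * maximalFn μ u x := by
  rw [← Measure.addHaar_ball_of_pos μ c (pos_of_mem_ball hx),
    ← measure_mul_setLAverage u measure_ball_lt_top.ne]
  gcongr
  exact setLAverage_ball_le_maximalFn hx

lemma mul_setLIntegral_dyadic_ball_le (u : E → ℝ≥0∞) (hδ : 0 < δ) (x z : E) (k : ℕ) :
    ENNReal.ofReal (δ ^ finrank ℝ E * (2 ^ k) ^ (-(finrank ℝ E + 1 : ℝ))) *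
      ∫⁻ w in ball z (2 ^ (k + 1) / δ), u w ∂μ ≤
    2⁻¹ ^ k * (2 ^ finrank ℝ E * ENNReal.ofReal ((1 + δ * dist z x) ^ finrank ℝ E) *
      μ (ball 0 1) * maximalFn μ u x) := by
  set d := finrank ℝ E
  set s := 1 + δ * dist z x
  have hs1 : 1 ≤ s := one_le_one_add_mul_dist hδ.le z x
  have hx : x ∈ ball z (2 ^ (k + 1) / δ * s) := by
    have hpow : (1 : ℝ) ≤ 2 ^ (k + 1) := one_le_pow₀ one_le_two
    rw [mem_ball', div_mul_eq_mul_div, lt_div_iff₀ hδ]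
    nlinarith
  have hball : ball z (2 ^ (k + 1) / δ) ⊆ ball z (2 ^ (k + 1) / δ * s) :=
    ball_subset_ball (le_mul_of_one_le_right (by positivity) hs1)
  have hconst : δ ^ d * (2 ^ k) ^ (-(d + 1 : ℝ)) * (2 ^ (k + 1) / δ * s) ^ d =
      2⁻¹ ^ k * (2 ^ d * s ^ d) := by
    rw [Real.rpow_neg (by positivity), ← Nat.cast_add_one, Real.rpow_natCast, mul_pow, div_pow,
      inv_pow]
    field_simp
    ring
  calc _ ≤ ENNReal.ofReal (δ ^ d * (2 ^ k) ^ (-(d + 1 : ℝ))) *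
        (ENNReal.ofReal ((2 ^ (k + 1) / δ * s) ^ d) * μ (ball 0 1) * maximalFn μ u x) := by
        gcongr
        exact (lintegral_mono_set hball).trans (setLIntegral_ball_le_maximalFn u hx)
    _ = ENNReal.ofReal (2⁻¹ ^ k * (2 ^ d * s ^ d)) * (μ (ball 0 1) * maximalFn μ u x) := by
        rw [← hconst, ENNReal.ofReal_mul (q := _ ^ d) (by positivity)]
        ring
    _ = _ := by
        rw [ENNReal.ofReal_mul (by positivity), ENNReal.ofReal_mul (by positivity),
          ENNReal.ofReal_pow (by norm_num), ENNReal.ofReal_pow (by norm_num),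
          ENNReal.ofReal_inv_of_pos (by norm_num), ENNReal.ofReal_ofNat]
        ring

lemma lintegral_mul_polyDecay_le (hu : Measurable u) (hδ : 0 < δ) (x z : E) :
    ENNReal.ofReal (δ ^ finrank ℝ E) * ∫⁻ w, u w * polyDecay δ (finrank ℝ E + 1) z w ∂μ ≤
      2 ^ (finrank ℝ E + 1) * ENNReal.ofReal ((1 + δ * dist z x) ^ finrank ℝ E) * μ (ball 0 1) *
        maximalFn μ u x := by
  set d := finrank ℝ E
  set B : ℕ → Set E := fun k => ball z (2 ^ (k + 1) / δ)
  set c : ℕ → ℝ≥0∞ := fun k => ENNReal.ofReal ((2 ^ k) ^ (-(d + 1 : ℝ)))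
  have hterm : ∀ w k, u w * (B k).indicator (fun _ => c k) w = c k * (B k).indicator u w := by
    intro w k
    by_cases hw : w ∈ B k <;> simp [hw, mul_comm]
  calc ENNReal.ofReal (δ ^ d) * ∫⁻ w, u w * polyDecay δ (d + 1) z w ∂μ
      ≤ ENNReal.ofReal (δ ^ d) * ∫⁻ w, ∑' k, c k * (B k).indicator u w ∂μ := by
        gcongr with w
        simp only [← hterm, ENNReal.tsum_mul_left]
        gcongr
        exact polyDecay_le_tsum_indicator_ball hδ (by positivity) z w
    _ = ∑' k, ENNReal.ofReal (δ ^ d * (2 ^ k) ^ (-(d + 1 : ℝ))) * ∫⁻ w in B k, u w ∂μ := by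
        rw [lintegral_tsum fun k => ((hu.indicator measurableSet_ball).const_mul _).aemeasurable,
          ← ENNReal.tsum_mul_left]
        refine tsum_congr fun k => ?_
        rw [lintegral_const_mul' _ _ ENNReal.ofReal_ne_top, lintegral_indicator measurableSet_ball,
          ENNReal.ofReal_mul (by positivity), mul_assoc]
    _ ≤ ∑' k : ℕ, 2⁻¹ ^ k * (2 ^ d * ENNReal.ofReal ((1 + δ * dist z x) ^ d) *
          μ (ball 0 1) * maximalFn μ u x) :=
        ENNReal.tsum_le_tsum fun k => mul_setLIntegral_dyadic_ball_le u hδ x z k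
    _ = _ := by
        rw [ENNReal.tsum_mul_right, ENNReal.tsum_geometric, ENNReal.one_sub_inv_two, inv_inv]
        ring

lemma lintegral_polyDecay_le (hδ : 0 < δ) (z : E) :
    ENNReal.ofReal (δ ^ finrank ℝ E) * ∫⁻ w, polyDecay δ (finrank ℝ E + 1) z w ∂μ ≤
      2 ^ (finrank ℝ E + 1) * μ (ball 0 1) := by
  have h := lintegral_mul_polyDecay_le (μ := μ) (u := fun _ => 1) measurable_const hδ z z
  simp only [one_mul, dist_self, mul_zero, add_zero, one_pow, ENNReal.ofReal_one, mul_one] at h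
  exact h.trans (mul_le_of_le_one_right' (maximalFn_const_le 1 z))

end Domination

section SelfImprovement

variable {α : Type*} [MeasurableSpace α] {μ : Measure α} {r : ℝ} {g : α → ℝ≥0∞}

lemma rpow_le_of_le_rpow_one_sub_mul {S I : ℝ≥0∞} (hS : S ≠ ∞) (hr : 0 < r)
    (h : S ≤ S ^ (1 - r) * I) : S ^ r ≤ I := by
  rcases eq_or_ne S 0 with rfl | hS0
  · simp [ENNReal.zero_rpow_of_pos hr]
  calc S ^ r = S ^ (r - 1) * S ^ (1 : ℝ) := by rw [← ENNReal.rpow_add _ _ hS0 hS, sub_add_cancel]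
    _ ≤ S ^ (r - 1) * (S ^ (1 - r) * I) := by rw [ENNReal.rpow_one]; gcongr
    _ = I := by rw [← mul_assoc, ← ENNReal.rpow_add _ _ hS0 hS]; simp

/-- The Strömberg–Torchinsky trick: with `S = sup_w g(w) k(z, w)`, submultiplicativity of `k` gives
`S ≤ sup_w ∫ g k(z, ·) ≤ S^{1-r} ∫ (g k(z, ·))^r`, and `S` may be divided out because it is
finite. -/
lemma rpow_le_lintegral_rpow_of_le_one {k : α → α → ℝ≥0∞} {z : α} (hr : 0 < r) (hr1 : r ≤ 1)
    (hself : k z z = 1) (hmul : ∀ v w, k z v * k v w ≤ k z w) (hbdd : ⨆ w, g w * k z w ≠ ∞)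
    (hg : ∀ v, g v ≤ ∫⁻ w, g w * k v w ∂μ) :
    g z ^ r ≤ ∫⁻ w, (g w * k z w) ^ r ∂μ := by
  set S := ⨆ w, g w * k z w
  have hle : ∀ w, g w * k z w ≤ S := fun w => le_iSup (fun w => g w * k z w) w
  have hinterp : ∀ w, g w * k z w ≤ S ^ (1 - r) * (g w * k z w) ^ r := fun w => by
    calc g w * k z w = (g w * k z w) ^ (1 - r) * (g w * k z w) ^ r := by
          rw [← ENNReal.rpow_add_of_nonneg _ _ (sub_nonneg.2 hr1) hr.le, sub_add_cancel,
            ENNReal.rpow_one]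
      _ ≤ S ^ (1 - r) * (g w * k z w) ^ r := by
          gcongr
          exact hle w
  have hS : S ≤ S ^ (1 - r) * ∫⁻ w, (g w * k z w) ^ r ∂μ := by
    refine iSup_le fun v => ?_
    calc g v * k z v ≤ k z v * ∫⁻ w, g w * k v w ∂μ := by rw [mul_comm]; gcongr; exact hg v
      _ ≤ ∫⁻ w, k z v * (g w * k v w) ∂μ := lintegral_const_mul_le _ _
      _ ≤ ∫⁻ w, S ^ (1 - r) * (g w * k z w) ^ r ∂μ := by
          refine lintegral_mono fun w => le_trans ?_ (hinterp w)
          rw [mul_left_comm]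
          exact mul_le_mul_right (hmul v w) _
      _ = S ^ (1 - r) * ∫⁻ w, (g w * k z w) ^ r ∂μ :=
          lintegral_const_mul' _ _ (ENNReal.rpow_ne_top_of_nonneg (sub_nonneg.2 hr1) hbdd)
  calc g z ^ r = (g z * k z z) ^ r := by rw [hself, mul_one]
    _ ≤ S ^ r := by gcongr; exact hle z
    _ ≤ _ := rpow_le_of_le_rpow_one_sub_mul hbdd hr hS

lemma rpow_lintegral_mul_le {k : α → ℝ≥0∞} (hr : 1 ≤ r) (hg : Measurable g) (hk : Measurable k) :
    (∫⁻ w, g w * k w ∂μ) ^ r ≤ (∫⁻ w, k w ∂μ) ^ (r - 1) * ∫⁻ w, g w ^ r * k w ∂μ := by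
  have hr0 : 0 < r := by linarith
  have hdensity : ∀ f : α → ℝ≥0∞, Measurable f →
      ∫⁻ w, f w * k w ∂μ = ∫⁻ w, f w ∂μ.withDensity k := fun f hf => by
    rw [lintegral_withDensity_eq_lintegral_mul _ hk hf]
    simp only [Pi.mul_apply, mul_comm]
  have hnorm := eLpNorm'_le_eLpNorm'_mul_rpow_measure_univ (μ := μ.withDensity k) one_pos hr
    hg.aestronglyMeasurable
  simp only [eLpNorm', enorm_eq_self, ENNReal.rpow_one, div_one, withDensity_apply _ .univ,
    Measure.restrict_univ] at hnorm
  rw [hdensity g hg, hdensity _ (hg.pow_const r)]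
  calc (∫⁻ w, g w ∂μ.withDensity k) ^ r
      ≤ ((∫⁻ w, g w ^ r ∂μ.withDensity k) ^ (1 / r) * (∫⁻ w, k w ∂μ) ^ (1 - 1 / r)) ^ r := by
        gcongr
    _ = _ := by
        rw [ENNReal.mul_rpow_of_nonneg _ _ hr0.le, ← ENNReal.rpow_mul, ← ENNReal.rpow_mul,
          one_div_mul_cancel hr0.ne', ENNReal.rpow_one, mul_comm, sub_mul, one_mul,
          one_div_mul_cancel hr0.ne']

end SelfImprovement

section PolyDecaySelfImprovement

variable {X : Type*} [PseudoMetricSpace X] [MeasurableSpace X] {μ : Measure X} {g : X → ℝ≥0∞}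
  {C : ℝ≥0∞} {δ r a b : ℝ}

lemma rpow_le_lintegral_rpow_mul_polyDecay (hδ : 0 ≤ δ) (hr : 0 < r) (hr1 : r ≤ 1) (ha : 0 ≤ a)
    (hb : b ≤ a * r) (hbdd : ⨆ w, g w ≠ ∞)
    (hg : ∀ v, g v ≤ C * ∫⁻ w, g w * polyDecay δ a v w ∂μ) (z : X) :
    g z ^ r ≤ C * ∫⁻ w, g w ^ r * polyDecay δ b z w ∂μ := by
  have hbdd' : ⨆ w, g w * polyDecay δ a z w ≠ ∞ := ne_top_of_le_ne_top hbdd <|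
    iSup_mono fun w => mul_le_of_le_one_right' (polyDecay_le_one hδ ha z w)
  simp only [← smul_eq_mul C, ← lintegral_smul_measure] at hg ⊢
  refine (rpow_le_lintegral_rpow_of_le_one hr hr1 (polyDecay_self δ a z)
    (polyDecay_mul_polyDecay_le hδ ha z) hbdd' hg).trans (lintegral_mono fun w => ?_)
  rw [ENNReal.mul_rpow_of_nonneg _ _ hr.le, polyDecay_rpow hδ hr.le]
  exact mul_le_mul_right (polyDecay_anti hδ hb z w) _

end PolyDecaySelfImprovement

section Peetre

open Module

variable {E : Type*} [NormedAddCommGroup E] [NormedSpace ℝ E] [FiniteDimensional ℝ E]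
  [MeasurableSpace E] [BorelSpace E] {μ : Measure E} [μ.IsAddHaarMeasure] {g : E → ℝ≥0∞}
  {C : ℝ≥0∞} {δ r L : ℝ}

lemma rpow_le_mul_rpow_sub_one_mul_lintegral_polyDecay (hδ : 0 < δ) (hr : 1 ≤ r)
    (hL : finrank ℝ E + 1 ≤ L) (hgm : Measurable g)
    (hg : ∀ v, g v ≤ C * ENNReal.ofReal (δ ^ finrank ℝ E) * ∫⁻ w, g w * polyDecay δ L v w ∂μ)
    (z : E) :
    g z ^ r ≤ (C * (2 ^ (finrank ℝ E + 1) * μ (ball 0 1))) ^ (r - 1) *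
      (C * ENNReal.ofReal (δ ^ finrank ℝ E) *
        ∫⁻ w, g w ^ r * polyDecay δ (finrank ℝ E + 1) z w ∂μ) := by
  set c := C * ENNReal.ofReal (δ ^ finrank ℝ E)
  have hmass : c * ∫⁻ w, polyDecay δ (finrank ℝ E + 1) z w ∂μ ≤
      C * (2 ^ (finrank ℝ E + 1) * μ (ball 0 1)) := by
    rw [mul_assoc]
    exact mul_le_mul_right (lintegral_polyDecay_le hδ z) C
  calc g z ^ r ≤ (c * ∫⁻ w, g w * polyDecay δ (finrank ℝ E + 1) z w ∂μ) ^ r := by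
        gcongr
        exact (hg z).trans <| mul_le_mul_right
          (lintegral_mono fun w => mul_le_mul_right (polyDecay_anti hδ.le hL z w) _) c
    _ ≤ (c * ∫⁻ w, polyDecay δ (finrank ℝ E + 1) z w ∂μ) ^ (r - 1) *
        (c * ∫⁻ w, g w ^ r * polyDecay δ (finrank ℝ E + 1) z w ∂μ) := by
        simp only [← smul_eq_mul c, ← lintegral_smul_measure]
        exact rpow_lintegral_mul_le hr hgm (measurable_polyDecay _ _ _)
    _ ≤ _ := mul_le_mul_left (ENNReal.rpow_le_rpow hmass (sub_nonneg.2 hr)) _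

lemma rpow_le_mul_maximalFn_of_le_lintegral_polyDecay (hδ : 0 < δ) (hr : 0 < r)
    (hL : finrank ℝ E + 1 ≤ L) (hLr : finrank ℝ E + 1 ≤ L * r) (hgm : Measurable g)
    (hbdd : ⨆ w, g w ≠ ∞)
    (hg : ∀ v, g v ≤ C * ENNReal.ofReal (δ ^ finrank ℝ E) * ∫⁻ w, g w * polyDecay δ L v w ∂μ)
    (x z : E) :
    g z ^ r ≤ (C * (2 ^ (finrank ℝ E + 1) * μ (ball 0 1))) ^ max 1 r *
      (ENNReal.ofReal ((1 + δ * dist z x) ^ finrank ℝ E) * maximalFn μ (fun w => g w ^ r) x) := by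
  set M := C * (2 ^ (finrank ℝ E + 1) * μ (ball 0 1)) with hM
  have hmax : C * ENNReal.ofReal (δ ^ finrank ℝ E) *
      ∫⁻ w, g w ^ r * polyDecay δ (finrank ℝ E + 1) z w ∂μ ≤
      M * (ENNReal.ofReal ((1 + δ * dist z x) ^ finrank ℝ E) *
        maximalFn μ (fun w => g w ^ r) x) := by
    rw [mul_assoc]
    exact (mul_le_mul_right (lintegral_mul_polyDecay_le (hgm.pow_const r) hδ x z) C).trans_eq
      (by rw [hM]; ring)
  rcases le_total r 1 with hr1 | hr1
  · rw [max_eq_left hr1, ENNReal.rpow_one]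
    exact (rpow_le_lintegral_rpow_mul_polyDecay hδ.le hr hr1 (by linarith) hLr hbdd hg z).trans hmax
  · have hpow : M ^ (r - 1) * M = M ^ r := by
      nth_rewrite 2 [← ENNReal.rpow_one M]
      rw [← ENNReal.rpow_add_of_nonneg _ _ (sub_nonneg.2 hr1) zero_le_one, sub_add_cancel]
    rw [max_eq_right hr1, ← hpow, mul_assoc]
    exact (rpow_le_mul_rpow_sub_one_mul_lintegral_polyDecay hδ hr1 hL hgm hg z).trans
      (mul_le_mul_right hmax _)

end Peetre

section Localization

variable {V E F : Type*} [NormedAddCommGroup V] [NormedSpace ℝ V] [FiniteDimensional ℝ V]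
  [NormedAddCommGroup E] [NormedSpace ℂ E] [AddCommGroup F] [Module ℂ F]

lemma exists_eq_sum_tsupport_subset {ι : Type*} {u : 𝓢(V, E)} (hu : HasCompactSupport u)
    {U : ι → Set V} (hU : ∀ i, IsOpen (U i)) (hcover : tsupport u ⊆ ⋃ i, U i) :
    ∃ (s : Finset ι) (v : ι → 𝓢(V, E)), (∀ i, tsupport (v i) ⊆ U i) ∧ u = ∑ i ∈ s, v i := by
  obtain ⟨ρ, hρ⟩ := SmoothPartitionOfUnity.exists_isSubordinate (modelWithCornersSelf ℝ V)
    (isClosed_tsupport u) U hU hcover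
  have hfin : {i | (Function.support (ρ i) ∩ tsupport u).Nonempty}.Finite :=
    ρ.locallyFinite.finite_nonempty_inter_compact hu
  have hsmooth (i : ι) : ContDiff ℝ ((⊤ : ℕ∞) : WithTop ℕ∞) fun x => ρ i x • u x :=
    (ρ i).contMDiff.contDiff.smul u.smooth'
  have hcompact (i : ι) : HasCompactSupport fun x => ρ i x • u x := hu.smul_left
  refine ⟨hfin.toFinset, fun i => (hcompact i).toSchwartzMap (hsmooth i),
    fun i => (tsupport_smul_subset_left (ρ i) u).trans (hρ i), ?_⟩
  ext x
  rw [sum_apply]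
  change u x = ∑ i ∈ hfin.toFinset, ρ i x • u x
  by_cases hx : x ∈ tsupport u
  · have hone := ρ.sum_eq_one hx
    rw [finsum_eq_sum_of_support_subset _ (s := hfin.toFinset)
      fun i hi => by simpa using ⟨x, hi, hx⟩] at hone
    rw [← Finset.sum_smul, hone, one_smul]
  · simp [image_eq_zero_of_notMem_tsupport hx]

lemma apply_eq_zero_of_disjoint_dsupport (T : 𝓢(V, E) →ₗ[ℂ] F) {u : 𝓢(V, E)}
    (hu : HasCompactSupport u) (hd : Disjoint (tsupport u) (Distribution.dsupport T)) :
    T u = 0 := by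
  have hloc (x : tsupport u) : ∃ U : Set V, Distribution.IsVanishingOn T U ∧ IsOpen U ∧ ↑x ∈ U :=
    (Distribution.notMem_dsupport_iff _).1 (Set.disjoint_left.1 hd x.2)
  choose U hTU hU hxU using hloc
  obtain ⟨s, v, hv, hsum⟩ := exists_eq_sum_tsupport_subset hu hU
    fun x hx => mem_iUnion.2 ⟨⟨x, hx⟩, hxU ⟨x, hx⟩⟩
  rw [hsum, map_sum]
  exact Finset.sum_eq_zero fun i _ => hTU i _ (hv i)

end Localization

section BandLimited

variable {V : Type*} [NormedAddCommGroup V] [InnerProductSpace ℝ V]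

lemma exists_norm_le_one_add_norm_rpow (θ : 𝓢(V, ℂ)) (L : ℕ) :
    ∃ C : ℝ≥0, ∀ x, ‖θ x‖ ≤ C * (1 + ‖x‖) ^ (-(L : ℝ)) := by
  set C := 2 ^ L * ((Finset.Iic (L, 0)).sup fun m => SchwartzMap.seminorm ℝ m.1 m.2) θ
  refine ⟨⟨C, by positivity⟩, fun x => ?_⟩
  have hx : (0 : ℝ) < 1 + ‖x‖ := by positivity
  have h := SchwartzMap.one_add_le_sup_seminorm_apply (𝕜 := ℝ) (m := (L, 0)) le_rfl le_rfl θ x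
  rw [norm_iteratedFDeriv_zero] at h
  rw [Real.rpow_neg hx.le, Real.rpow_natCast, ← div_eq_mul_inv, le_div_iff₀' (by positivity)]
  exact h

variable [FiniteDimensional ℝ V]

variable (V) in
lemma exists_schwartzMap_eq_one_on_closedBall :
    ∃ χ : 𝓢(V, ℂ), ∀ ξ ∈ closedBall (0 : V) 2, χ ξ = 1 := by
  let β : ContDiffBump (0 : V) := ⟨2, 3, by norm_num, by norm_num⟩
  refine ⟨(β.hasCompactSupport.comp_left Complex.ofReal_zero).toSchwartzMap
    (Complex.ofRealCLM.contDiff.comp β.contDiff), fun ξ hξ => ?_⟩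
  exact congrArg Complex.ofReal (β.one_of_mem_closedBall hξ)

variable [MeasurableSpace V] [BorelSpace V]

lemma fourier_compSubConstCLM (b : 𝓢(V, ℂ)) (ξ x : V) :
    𝓕 (b.compSubConstCLM ℂ ξ) x = Real.fourierChar (-inner ℝ x ξ) • 𝓕 b x := by
  have h := congrFun (VectorFourier.fourierIntegral_comp_add_right Real.fourierChar
    (volume : Measure V) (innerₗ V) (b : V → ℂ) (-ξ)) x
  have htranslate : (b : V → ℂ) ∘ (fun v => v + -ξ) = b.compSubConstCLM ℂ ξ := by
    ext v
    simp [sub_eq_add_neg]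
  rw [htranslate, innerₗ_apply_apply, inner_neg_left, real_inner_comm] at h
  exact h

lemma eq_integral_mul_fourier {F m : V → ℂ} (hFc : Continuous F) (hF : Integrable F)
    (hFs : HasCompactSupport (𝓕 F)) (hm : Integrable m) {z : V}
    (hmF : ∀ ξ, 𝓕 F ξ ≠ 0 → m ξ = Real.fourierChar (inner ℝ ξ z)) :
    F z = ∫ w, F w * 𝓕 m w := by
  have hFhat : Integrable (𝓕 F) := Continuous.integrable_of_hasCompactSupport
    (VectorFourier.fourierIntegral_continuous Real.continuous_fourierChar
      (by exact continuous_inner) hF) hFs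
  calc F z = 𝓕⁻ (𝓕 F) z := by rw [hFc.fourierInv_fourier_eq hF hFhat]
    _ = ∫ ξ, 𝓕 F ξ * m ξ := by
      rw [Real.fourierInv_eq]
      refine integral_congr_ae (Eventually.of_forall fun ξ => ?_)
      by_cases hξ : 𝓕 F ξ = 0
      · simp [hξ]
      · simp only [hmF ξ hξ, Circle.smul_def, smul_eq_mul, mul_comm]
    _ = ∫ w, F w * 𝓕 m w := by
      simpa [flip_innerₗ] using! VectorFourier.integral_fourierIntegral_smul_eq_flip
        (L := innerₗ V) Real.continuous_fourierChar (by exact continuous_inner) hF hm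

lemma norm_fourier_comp_dilation (χ : V → ℂ) {δ : ℝ} (hδ : 0 < δ) (ξ₀ z w : V) :
    ‖𝓕 (fun ξ => χ (δ⁻¹ • (ξ - ξ₀)) * (Real.fourierChar (inner ℝ ξ z) : ℂ)) w‖ =
      δ ^ Module.finrank ℝ V * ‖𝓕⁻ χ (δ • (z - w))‖ := by
  set G : V → ℂ := fun ζ => (Real.fourierChar (inner ℝ ξ₀ (z - w)) : ℂ) *
    (Real.fourierChar (inner ℝ ζ (δ • (z - w))) • χ ζ) with hG
  have hphase (ξ : V) : -inner ℝ ξ w + inner ℝ ξ z =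
      inner ℝ ξ₀ (z - w) + inner ℝ (δ⁻¹ • (ξ - ξ₀)) (δ • (z - w)) := by
    rw [real_inner_smul_left, real_inner_smul_right, ← mul_assoc, inv_mul_cancel₀ hδ.ne', one_mul,
      inner_sub_left, inner_sub_right, inner_sub_right]
    ring
  have hGint : 𝓕 (fun ξ => χ (δ⁻¹ • (ξ - ξ₀)) * (Real.fourierChar (inner ℝ ξ z) : ℂ)) w =
      ∫ ξ, G (δ⁻¹ • (ξ - ξ₀)) := by
    rw [Real.fourier_eq]
    refine integral_congr_ae (Eventually.of_forall fun ξ => ?_)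
    have h := congrArg (fun t => (Real.fourierChar t : ℂ)) (hphase ξ)
    simp only [AddChar.map_add_eq_mul, Circle.coe_mul] at h
    simp only [hG, Circle.smul_def, smul_eq_mul]
    linear_combination χ (δ⁻¹ • (ξ - ξ₀)) * h
  rw [hGint, integral_sub_right_eq_self fun ξ => G (δ⁻¹ • ξ), Measure.integral_comp_inv_smul,
    integral_const_mul, ← Real.fourierInv_eq, norm_smul, norm_mul, Circle.norm_coe, one_mul]
  simp [abs_of_pos hδ]

variable (V) in
lemma exists_enorm_le_lintegral_polyDecay (L : ℕ) :
    ∃ C : ℝ≥0, ∀ δ : ℝ, 0 < δ → ∀ (ξ₀ : V) (F : V → ℂ), Continuous F → Integrable F →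
      (∀ ξ, 2 * δ < dist ξ ξ₀ → 𝓕 F ξ = 0) → ∀ z, ‖F z‖ₑ ≤
        C * ENNReal.ofReal (δ ^ Module.finrank ℝ V) * ∫⁻ w, ‖F w‖ₑ * polyDecay δ L z w := by
  obtain ⟨χ, hχ⟩ := exists_schwartzMap_eq_one_on_closedBall V
  obtain ⟨C, hC⟩ := exists_norm_le_one_add_norm_rpow (𝓕⁻ χ) L
  refine ⟨C, fun δ hδ ξ₀ F hFc hF hspec z => ?_⟩
  have hball (ξ : V) (hξ : 𝓕 F ξ ≠ 0) : ξ ∈ closedBall ξ₀ (2 * δ) :=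
    not_lt.1 fun h => hξ (hspec ξ h)
  set m : V → ℂ := fun ξ => χ (δ⁻¹ • (ξ - ξ₀)) * (Real.fourierChar (inner ℝ ξ z) : ℂ)
  have hm : Integrable m := by
    refine Integrable.mul_bdd (c := 1) (((integrable_comp_smul_iff volume (χ : V → ℂ)
      (inv_ne_zero hδ.ne')).2 χ.integrable).comp_sub_right ξ₀) ?_
      (Eventually.of_forall fun ξ => (Circle.norm_coe _).le)
    exact Continuous.aestronglyMeasurable (by fun_prop)
  have hmF (ξ : V) (hξ : 𝓕 F ξ ≠ 0) : m ξ = Real.fourierChar (inner ℝ ξ z) := by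
    have hmem : δ⁻¹ • (ξ - ξ₀) ∈ closedBall (0 : V) 2 := by
      rw [mem_closedBall_zero_iff, norm_smul, ← dist_eq_norm, norm_inv, Real.norm_of_nonneg hδ.le,
        inv_mul_le_iff₀ hδ, mul_comm]
      exact hball ξ hξ
    simp only [m, hχ _ hmem, one_mul]
  have hkernel (w : V) :
      ‖𝓕 m w‖ₑ ≤ C * ENNReal.ofReal (δ ^ Module.finrank ℝ V) * polyDecay δ L z w := by
    rw [← ofReal_norm, norm_fourier_comp_dilation _ hδ, polyDecay, ← ENNReal.ofReal_coe_nnreal,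
      ← ENNReal.ofReal_mul C.coe_nonneg, ← ENNReal.ofReal_mul (by positivity), mul_comm (C : ℝ),
      mul_assoc]
    have h := hC (δ • (z - w))
    rw [SchwartzMap.fourierInv_coe, norm_smul, Real.norm_of_nonneg hδ.le, ← dist_eq_norm] at h
    gcongr
  rw [eq_integral_mul_fourier hFc hF (HasCompactSupport.of_support_subset_isCompact
    (isCompact_closedBall ξ₀ (2 * δ)) hball) hm hmF, ← lintegral_const_mul' _ _ (by finiteness)]
  refine (enorm_integral_le_lintegral_enorm _).trans (lintegral_mono fun w => ?_)
  rw [enorm_mul, mul_left_comm]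
  exact mul_le_mul_right (hkernel w) _

variable (V) in
lemma exists_rpow_le_maximalFn_of_integrable {r : ℝ} (hr : 0 < r) :
    ∃ C : ℝ≥0, ∀ δ : ℝ, 0 < δ → ∀ (ξ₀ : V) (F : V → ℂ), Continuous F → Integrable F →
      (∀ ξ, 2 * δ < dist ξ ξ₀ → 𝓕 F ξ = 0) → ∀ x z, ‖F z‖ₑ ^ r ≤
        C * (ENNReal.ofReal ((1 + δ * dist z x) ^ Module.finrank ℝ V) *
          maximalFn volume (fun w => ‖F w‖ₑ ^ r) x) := by
  obtain ⟨L, hL⟩ := exists_nat_ge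
    (max ((Module.finrank ℝ V : ℝ) + 1) (((Module.finrank ℝ V : ℝ) + 1) / r))
  obtain ⟨C, hC⟩ := exists_enorm_le_lintegral_polyDecay V L
  obtain ⟨K, hK⟩ : ∃ K : ℝ≥0, (K : ℝ≥0∞) =
      (C * (2 ^ (Module.finrank ℝ V + 1) * volume (ball (0 : V) 1))) ^ max 1 r :=
    WithTop.ne_top_iff_exists.1 <| ENNReal.rpow_ne_top_of_nonneg (by positivity) <|
      ENNReal.mul_ne_top (by finiteness) (ENNReal.mul_ne_top (by finiteness) measure_ball_lt_top.ne)
  refine ⟨K, fun δ hδ ξ₀ F hFc hF hspec x z => ?_⟩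
  have hbound (w : V) : ‖F w‖ₑ ≤
      C * ENNReal.ofReal (δ ^ Module.finrank ℝ V) * ∫⁻ w, ‖F w‖ₑ := by
    refine (hC δ hδ ξ₀ F hFc hF hspec w).trans (mul_le_mul_right (lintegral_mono fun v => ?_) _)
    exact mul_le_of_le_one_right' (polyDecay_le_one hδ.le L.cast_nonneg w v)
  rw [hK]
  refine rpow_le_mul_maximalFn_of_le_lintegral_polyDecay hδ hr ((le_max_left _ _).trans hL)
    ((div_le_iff₀ hr).1 ((le_max_right _ _).trans hL)) hFc.enorm.measurable
    (ne_top_of_le_ne_top (ENNReal.mul_ne_top (by finiteness) hF.2.ne) (iSup_le hbound))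
    (hC δ hδ ξ₀ F hFc hF hspec) x z

lemma norm_fourier_normed_le_one (φ : ContDiffBump (0 : V)) (x : V) :
    ‖𝓕 (fun y => (φ.normed volume y : ℂ)) x‖ ≤ 1 := by
  rw [Real.fourier_eq, ← φ.integral_normed (μ := volume)]
  refine (norm_integral_le_integral_norm _).trans_eq ?_
  simp [Real.norm_of_nonneg (φ.nonneg_normed _), Circle.norm_smul]

lemma tendsto_fourier_normed {φ : ℕ → ContDiffBump (0 : V)}
    (hφ : Tendsto (fun k => (φ k).rOut) atTop (𝓝 0)) (x : V) :
    Tendsto (fun k => 𝓕 (fun y => ((φ k).normed volume y : ℂ)) x) atTop (𝓝 1) := by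
  have h := ContDiffBump.convolution_tendsto_right_of_continuous (μ := volume) hφ
    (g := fun y : V => (Real.fourierChar (inner ℝ y x) : ℂ)) (by fun_prop) 0
  simp only [inner_zero_left, AddChar.map_zero_eq_one, Circle.coe_one] at h
  refine h.congr fun k => ?_
  rw [Real.fourier_eq, convolution_def]
  refine integral_congr_ae (Eventually.of_forall fun y => ?_)
  simp only [ContinuousLinearMap.lsmul_apply, zero_sub, inner_neg_left, Circle.smul_def,
    smul_eq_mul, Complex.real_smul]
  ring

variable (V) in
lemma exists_seq_tendsto_fourier_one {δ : ℝ} (hδ : 0 < δ) :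
    ∃ b : ℕ → 𝓢(V, ℂ), (∀ k, tsupport (b k) ⊆ closedBall 0 δ) ∧ (∀ k x, ‖𝓕 (b k) x‖ ≤ 1) ∧
      ∀ x, Tendsto (fun k => 𝓕 (b k) x) atTop (𝓝 1) := by
  let φ (k : ℕ) : ContDiffBump (0 : V) :=
    ⟨δ / (k + 1) / 2, δ / (k + 1), by positivity, half_lt_self (by positivity)⟩
  have hφ : Tendsto (fun k => (φ k).rOut) atTop (𝓝 0) := by
    simpa [φ, div_eq_mul_inv] using
      (tendsto_one_div_add_atTop_nhds_zero_nat (𝕜 := ℝ)).const_mul δ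
  refine ⟨fun k => ((φ k).hasCompactSupport_normed.comp_left Complex.ofReal_zero).toSchwartzMap
    (Complex.ofRealCLM.contDiff.comp (φ k).contDiff_normed), fun k => ?_,
    fun k => norm_fourier_normed_le_one (φ k), tendsto_fourier_normed hφ⟩
  refine (tsupport_comp_subset Complex.ofReal_zero _).trans ?_
  rw [(φ k).tsupport_normed_eq]
  exact closedBall_subset_closedBall (div_le_self hδ.le (by simp))

end BandLimited

lemma IsGivenBy.fourier_fourier_mul_eq_zero {n : ℕ} {Ω : Set (Rn n)} {f : Rn n → ℂ}
    {T : 𝓢'(Rn n, ℂ)} (hT : IsGivenBy T f)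
    (hΩ : Distribution.dsupport (𝓕 T : 𝓢'(Rn n, ℂ)) ⊆ Ω) {b : 𝓢(Rn n, ℂ)} {δ : ℝ}
    (hb : tsupport b ⊆ closedBall 0 δ) {ξ : Rn n} (hξ : Disjoint (closedBall ξ δ) Ω) :
    𝓕 (fun x => 𝓕 b x * f x) ξ = 0 := by
  set v := b.compSubConstCLM ℂ ξ
  have hv : tsupport v ⊆ closedBall ξ δ := by
    refine closure_minimal (fun y hy => ?_) isClosed_closedBall
    simpa [dist_eq_norm] using hb (subset_tsupport b hy)
  calc 𝓕 (fun x => 𝓕 b x * f x) ξ = (𝓕 T : 𝓢'(Rn n, ℂ)) v := by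
        rw [TemperedDistribution.fourier_apply, (hT (𝓕 v)).2, Real.fourier_eq]
        simp only [v, fourier_compSubConstCLM, smul_mul_assoc]
    _ = 0 := apply_eq_zero_of_disjoint_dsupport (𝓕 T : 𝓢'(Rn n, ℂ)).toLinearMap
        (HasCompactSupport.of_support_subset_isCompact (isCompact_closedBall ξ δ)
          ((subset_tsupport _).trans hv)) (Set.disjoint_of_subset hv hΩ hξ)

lemma IsBandLimited.exists_rpow_le_maximalFn (n : ℕ) {r : ℝ} (hr : 0 < r) :
    ∃ C : ℝ≥0, ∀ (δ : ℝ) (ξ₀ : Rn n) (Ω : Set (Rn n)) (f : Rn n → ℂ), 0 < δ →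
      Ω ⊆ closedBall ξ₀ δ → IsBandLimited Ω f → ∀ x z, ‖f z‖ₑ ^ r ≤ C *
        (ENNReal.ofReal ((1 + δ * dist z x) ^ n) * maximalFn volume (fun w => ‖f w‖ₑ ^ r) x) := by
  obtain ⟨C, hC⟩ := exists_rpow_le_maximalFn_of_integrable (Rn n) hr
  rw [finrank_euclideanSpace_fin] at hC
  refine ⟨C, fun δ ξ₀ Ω f hδ hΩ ⟨hf, T, hT, hsupp⟩ x z => ?_⟩
  obtain ⟨b, hb, hb_le, hb_lim⟩ := exists_seq_tendsto_fourier_one (Rn n) hδ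
  have hspec (k : ℕ) (ξ : Rn n) (hξ : 2 * δ < dist ξ ξ₀) : 𝓕 (fun w => 𝓕 (b k) w * f w) ξ = 0 :=
    hT.fourier_fourier_mul_eq_zero hsupp (hb k) <|
      (closedBall_disjoint_closedBall (by linarith)).mono_right hΩ
  have hle (k : ℕ) (w : Rn n) : ‖𝓕 (b k) w * f w‖ₑ ^ r ≤ ‖f w‖ₑ ^ r := by
    refine ENNReal.rpow_le_rpow ?_ hr.le
    rw [← ofReal_norm, ← ofReal_norm, norm_mul]
    exact ENNReal.ofReal_le_ofReal (mul_le_of_le_one_left (norm_nonneg _) (hb_le k w))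
  have hlim : Tendsto (fun k => ‖𝓕 (b k) z * f z‖ₑ ^ r) atTop
      (𝓝 (‖f z‖ₑ ^ r)) := by
    refine (ENNReal.continuous_rpow_const.tendsto _).comp ?_
    simpa using ((hb_lim z).mul_const (f z)).enorm
  refine le_of_tendsto' hlim fun k => ?_
  refine (hC δ hδ ξ₀ _ ((𝓕 (b k)).continuous.mul hf) (hT (𝓕 (b k))).1 (hspec k) x z).trans ?_
  exact mul_le_mul_right (mul_le_mul_right (maximalFn_mono (hle k) x) _) _

section Cube

variable {n : ℕ}

lemma cube_eq_preimage (x : Rn n) (ℓ : ℝ) :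
    cube x ℓ = (WithLp.ofLp : Rn n → Fin n → ℝ) ⁻¹'
      Icc (fun i => x i - ℓ / 2) (fun i => x i + ℓ / 2) := by
  ext y
  simp only [cube, mem_ofPred_eq, mem_preimage, mem_Icc, Pi.le_def, abs_le, ← forall_and]
  refine forall_congr' fun i => ?_
  constructor <;> rintro ⟨h1, h2⟩ <;> constructor <;> linarith

lemma measurableSet_cube (x : Rn n) (ℓ : ℝ) : MeasurableSet (cube x ℓ) := by
  rw [cube_eq_preimage]
  exact measurableSet_Icc.preimage (PiLp.volume_preserving_ofLp (Fin n)).measurable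

lemma volume_cube (x : Rn n) {ℓ : ℝ} (hℓ : 0 ≤ ℓ) :
    volume (cube x ℓ) = ENNReal.ofReal (ℓ ^ n) := by
  have hside : ∀ i, x i + ℓ / 2 - (x i - ℓ / 2) = ℓ := fun i => by ring
  rw [cube_eq_preimage, (PiLp.volume_preserving_ofLp (Fin n)).measure_preimage
    measurableSet_Icc.nullMeasurableSet, Real.volume_Icc_pi]
  simp [hside, ENNReal.ofReal_pow hℓ]

lemma volume_cube_ne_zero (x : Rn n) {ℓ : ℝ} (hℓ : 0 < ℓ) : volume (cube x ℓ) ≠ 0 := by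
  rw [volume_cube x hℓ.le]
  exact (ENNReal.ofReal_pos.2 (by positivity)).ne'

lemma volume_cube_ne_top (x : Rn n) {ℓ : ℝ} (hℓ : 0 ≤ ℓ) : volume (cube x ℓ) ≠ ∞ := by
  rw [volume_cube x hℓ]
  exact ENNReal.ofReal_ne_top

lemma volume_cube_five_mul (x : Rn n) {ℓ : ℝ} (hℓ : 0 ≤ ℓ) :
    volume (cube x (5 * ℓ)) = 5 ^ n * volume (cube x ℓ) := by
  rw [volume_cube x hℓ, volume_cube x (by positivity), mul_pow,
    ENNReal.ofReal_mul (by positivity), ENNReal.ofReal_pow (by norm_num), ENNReal.ofReal_ofNat]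

lemma exists_volume_cube_five_mul_le_volume_ball (n : ℕ) :
    ∃ a : ℝ≥0, ∀ (x c : Rn n) (ρ : ℝ), 0 < ρ →
      volume (cube x (5 * ρ)) ≤ a * volume (ball c ρ) := by
  have hball : volume (ball (0 : Rn n) 1) ≠ 0 := (measure_ball_pos _ _ one_pos).ne'
  lift (5 ^ n / volume (ball (0 : Rn n) 1)) to ℝ≥0 using
    ENNReal.div_ne_top (by finiteness) hball with a ha
  refine ⟨a, fun x c ρ hρ => le_of_eq ?_⟩
  rw [ha, volume_cube_five_mul x hρ.le, volume_cube x hρ.le, Measure.addHaar_ball_of_pos _ c hρ,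
    finrank_euclideanSpace_fin, mul_left_comm, ENNReal.div_mul_cancel hball measure_ball_lt_top.ne,
    mul_comm]

lemma volume_ball_five_mul_le (c : Rn n) (ρ : ℝ) :
    volume (ball c (5 * ρ)) ≤ 5 ^ n * volume (ball c ρ) := by
  simpa only [finrank_euclideanSpace_fin] using addHaar_ball_five_mul (μ := volume) c ρ

lemma cube_mono (x : Rn n) {ℓ ℓ' : ℝ} (h : ℓ ≤ ℓ') : cube x ℓ ⊆ cube x ℓ' := fun _ hy i =>
  (hy i).trans (by linarith)

lemma ball_subset_cube {x₀ x c : Rn n} {ℓ ρ : ℝ} (hx : x ∈ cube x₀ ℓ) (hxc : x ∈ ball c ρ) :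
    ball c ρ ⊆ cube x₀ (4 * ρ + ℓ) := by
  intro y hy i
  have hcoord : |y i - x i| ≤ dist y x := by
    simpa [dist_eq_norm] using PiLp.norm_apply_le (y - x) i
  have hdist : dist y x ≤ dist y c + dist x c := dist_triangle_right y x c
  have htri : |y i - x₀ i| ≤ |y i - x i| + |x i - x₀ i| := abs_sub_le _ _ _
  linarith [hx i, mem_ball.1 hy, mem_ball.1 hxc]

lemma setLAverage_cube_le_mul_of_le (x : Rn n) {τ s : ℝ} (hτ : 0 < τ) (hs : τ ≤ s)
    (u : Rn n → ℝ≥0∞) :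
    ⨍⁻ y in cube x τ, u y ∂volume ≤
      ENNReal.ofReal ((s / τ) ^ n) * ⨍⁻ y in cube x s, u y ∂volume := by
  have hs₀ : 0 < s := hτ.trans_le hs
  rw [setLAverage_eq, ENNReal.div_le_iff (volume_cube_ne_zero x hτ) (volume_cube_ne_top x hτ.le)]
  calc ∫⁻ y in cube x τ, u y ≤ ∫⁻ y in cube x s, u y := lintegral_mono_set (cube_mono x hs)
    _ = volume (cube x s) * ⨍⁻ y in cube x s, u y ∂volume :=
        (measure_mul_setLAverage u (volume_cube_ne_top x hs₀.le)).symm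
    _ = ENNReal.ofReal ((s / τ) ^ n) * (⨍⁻ y in cube x s, u y ∂volume) * volume (cube x τ) := by
        rw [volume_cube x hs₀.le, volume_cube x hτ.le, mul_right_comm,
          ← ENNReal.ofReal_mul (by positivity), ← mul_pow, div_mul_cancel₀ s hτ.ne']

end Cube

section MorreyNorm

variable {n : ℕ} {p : ℝ} {φ : Rn n → ℝ → ℝ} {g h : Rn n → ℝ≥0∞}

lemma morreyNorm_le_iff (hp : 0 < p) (hφ : ∀ x t, 0 < t → 0 < φ x t) {B : ℝ≥0∞} :
    morreyNorm p φ g ≤ B ↔ ∀ x ℓ, 0 < ℓ →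
      ⨍⁻ y in cube x ℓ, g y ^ p ∂volume ≤ (ENNReal.ofReal (φ x ℓ) * B) ^ p := by
  simp only [morreyNorm, iSup_le_iff]
  refine forall₃_congr fun x ℓ hℓ => ?_
  rw [mul_comm, ← div_eq_mul_inv, ENNReal.div_le_iff (ENNReal.ofReal_pos.2 (hφ x ℓ hℓ)).ne'
    ENNReal.ofReal_ne_top, one_div, ENNReal.rpow_inv_le_iff hp, setLAverage_eq,
    ENNReal.div_eq_inv_mul, mul_comm B]

lemma morreyNorm_mono (hp : 0 < p) (φ : Rn n → ℝ → ℝ) (hgh : g ≤ h) :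
    morreyNorm p φ g ≤ morreyNorm p φ h := by
  unfold morreyNorm
  gcongr
  exact hgh _

lemma morreyNorm_const_mul_le (hp : 0 < p) (hφ : ∀ x t, 0 < t → 0 < φ x t) (c : ℝ≥0)
    (g : Rn n → ℝ≥0∞) : morreyNorm p φ (fun x => c * g x) ≤ c * morreyNorm p φ g := by
  refine (morreyNorm_le_iff hp hφ).2 fun x ℓ hℓ => ?_
  calc ⨍⁻ y in cube x ℓ, (c * g y) ^ p ∂volume
      = (c : ℝ≥0∞) ^ p * ⨍⁻ y in cube x ℓ, g y ^ p ∂volume := by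
        simp_rw [ENNReal.mul_rpow_of_nonneg _ _ hp.le]
        exact lintegral_const_mul' _ _ (by finiteness)
    _ ≤ (c : ℝ≥0∞) ^ p * (ENNReal.ofReal (φ x ℓ) * morreyNorm p φ g) ^ p :=
        mul_le_mul_right ((morreyNorm_le_iff hp hφ).1 le_rfl x ℓ hℓ) _
    _ = (ENNReal.ofReal (φ x ℓ) * (c * morreyNorm p φ g)) ^ p := by
        rw [← ENNReal.mul_rpow_of_nonneg _ _ hp.le, mul_left_comm]

lemma weakMorreyNorm_mono (hp : 0 < p) (φ : Rn n → ℝ → ℝ) (hgh : g ≤ h) :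
    weakMorreyNorm p φ g ≤ weakMorreyNorm p φ h := by
  unfold weakMorreyNorm
  gcongr
  exact morreyNorm_mono hp φ (indicator_le_indicator_of_subset
    (fun y hy => lt_of_lt_of_le hy (hgh y)) fun _ => zero_le)

lemma weakMorreyNorm_const_mul_le (p : ℝ) (φ : Rn n → ℝ → ℝ) {c : ℝ≥0} (hc : 0 < c)
    (g : Rn n → ℝ≥0∞) : weakMorreyNorm p φ (fun x => c * g x) ≤ c * weakMorreyNorm p φ g := by
  have hc₀ : (c : ℝ≥0∞) ≠ 0 := by exact_mod_cast hc.ne'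
  refine iSup₂_le fun T hT => ?_
  have hT' : ENNReal.ofReal T = c * ENNReal.ofReal (T / c) := by
    rw [ENNReal.ofReal_div_of_pos (NNReal.coe_pos.2 hc), ENNReal.ofReal_coe_nnreal,
      ENNReal.mul_div_cancel hc₀ ENNReal.coe_ne_top]
  have hlevel : {x | ENNReal.ofReal T < c * g x} = {x | ENNReal.ofReal (T / c) < g x} := by
    simp only [hT', ENNReal.mul_lt_mul_iff_right hc₀ ENNReal.coe_ne_top]
  rw [hlevel, hT', mul_assoc]
  have hTc : 0 < T / c := div_pos hT hc
  refine mul_le_mul_right ?_ _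
  exact le_iSup₂_of_le (T / c) hTc le_rfl

lemma weakMorreyNorm_le (hp : 0 < p) (hφ : ∀ x t, 0 < t → 0 < φ x t) {B : ℝ≥0∞}
    (hB : ∀ T x ℓ, 0 < T → 0 < ℓ →
      ENNReal.ofReal T ^ p * volume ({y | ENNReal.ofReal T < g y} ∩ cube x ℓ) ≤
        (ENNReal.ofReal (φ x ℓ) * B) ^ p * volume (cube x ℓ)) :
    weakMorreyNorm p φ g ≤ B := by
  refine iSup₂_le fun T hT => ?_
  have hT₀ : ENNReal.ofReal T ≠ 0 := (ENNReal.ofReal_pos.2 hT).ne'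
  rw [mul_comm, ← ENNReal.le_div_iff_mul_le (.inl hT₀) (.inl ENNReal.ofReal_ne_top),
    morreyNorm_le_iff hp hφ]
  intro x ℓ hℓ
  set E := {y | ENNReal.ofReal T < g y}
  have hindicator : ∀ y, E.indicator (fun _ => (1 : ℝ≥0∞)) y ^ p = E.indicator 1 y := fun y => by
    by_cases hy : y ∈ E <;> simp [hy, hp]
  have hTp : ENNReal.ofReal T ^ p ≠ 0 := by simpa [hp, hp.le] using hT
  simp_rw [hindicator]
  rw [← mul_div_assoc, ENNReal.div_rpow_of_nonneg _ _ hp.le,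
    ENNReal.le_div_iff_mul_le (.inl hTp) (.inl (by finiteness)), setLAverage_eq,
    ← ENNReal.mul_div_right_comm,
    ENNReal.div_le_iff (volume_cube_ne_zero x hℓ) (volume_cube_ne_top x hℓ.le), mul_comm]
  refine (mul_le_mul_right ?_ _).trans (hB T x ℓ hT hℓ)
  calc ∫⁻ y in cube x ℓ, E.indicator 1 y ≤ ∫⁻ _ in E, 1 ∂volume.restrict (cube x ℓ) :=
        lintegral_indicator_le _ _
    _ = volume (E ∩ cube x ℓ) := by
        rw [setLIntegral_one, Measure.restrict_apply' (measurableSet_cube x ℓ)]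

end MorreyNorm

section SupremalCondition

variable {n : ℕ} {p r : ℝ} {φ₁ φ₂ : Rn n → ℝ → ℝ}

lemma setLAverage_cube_rpow_le (hr : 0 < r) (hp : 0 < p) (hφ₁ : ∀ x t, 0 < t → 0 < φ₁ x t)
    (g : Rn n → ℝ≥0∞) (x : Rn n) {τ s : ℝ} (hτ : 0 < τ) (hs : τ < s) :
    (⨍⁻ y in cube x τ, g y ^ p ∂volume) ^ (r / p) ≤
      morreyNorm p φ₁ g ^ r * ENNReal.ofReal (τ ^ (-((n : ℝ) * r / p))) *
        ENNReal.ofReal (φ₁ x s ^ r * s ^ ((n : ℝ) * r / p)) := by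
  have hs₀ : 0 < s := hτ.trans hs
  have hφ : 0 ≤ φ₁ x s := (hφ₁ x s hs₀).le
  have hrp : 0 ≤ r / p := by positivity
  have hscale : ((s / τ) ^ n) ^ (r / p) = s ^ ((n : ℝ) * r / p) * τ ^ (-((n : ℝ) * r / p)) := by
    rw [← Real.rpow_natCast, ← Real.rpow_mul (by positivity), ← mul_div_assoc,
      Real.div_rpow hs₀.le hτ.le, Real.rpow_neg hτ.le, div_eq_mul_inv]
  calc (⨍⁻ y in cube x τ, g y ^ p ∂volume) ^ (r / p)
      ≤ (ENNReal.ofReal ((s / τ) ^ n) *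
          (ENNReal.ofReal (φ₁ x s) * morreyNorm p φ₁ g) ^ p) ^ (r / p) := by
        refine ENNReal.rpow_le_rpow ?_ hrp
        refine (setLAverage_cube_le_mul_of_le x hτ hs.le _).trans (mul_le_mul_right ?_ _)
        exact (morreyNorm_le_iff hp hφ₁).1 le_rfl x s hs₀
    _ = ENNReal.ofReal (((s / τ) ^ n) ^ (r / p)) *
          (ENNReal.ofReal (φ₁ x s ^ r) * morreyNorm p φ₁ g ^ r) := by
        rw [ENNReal.mul_rpow_of_nonneg _ _ hrp, ← ENNReal.rpow_mul, mul_div_cancel₀ _ hp.ne',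
          ENNReal.mul_rpow_of_nonneg _ _ hr.le, ENNReal.ofReal_rpow_of_nonneg hφ hr.le,
          ENNReal.ofReal_rpow_of_nonneg (by positivity) hrp]
    _ = _ := by
        rw [hscale, ENNReal.ofReal_mul (by positivity), ENNReal.ofReal_mul (by positivity)]
        ring

lemma SupremalCondition.exists_setLAverage_cube_le (hr : 0 < r) (hp : 0 < p)
    (hφ₁ : ∀ x t, 0 < t → 0 < φ₁ x t) (hφ₂ : ∀ x t, 0 < t → 0 < φ₂ x t)
    (h : SupremalCondition p r φ₁ φ₂) :
    ∃ A : ℝ≥0, ∀ g : Rn n → ℝ≥0∞, morreyNorm p φ₁ g ≠ ∞ → ∀ x t τ, 0 < t → t < τ →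
      ⨍⁻ y in cube x τ, g y ^ p ∂volume ≤
        (ENNReal.ofReal (φ₂ x t) * (A * morreyNorm p φ₁ g)) ^ p := by
  obtain ⟨A, hA⟩ := h
  refine ⟨A ^ (1 / r), fun g hg x t τ ht hτ => ?_⟩
  have hτ₀ : 0 < τ := ht.trans hτ
  set K := morreyNorm p φ₁ g ^ r
  set w := ENNReal.ofReal (τ ^ (-((n : ℝ) * r / p)))
  have hKw : K * w ≠ ∞ := by finiteness
  have hne : Nonempty {s // τ < s} := ⟨τ + 1, by linarith⟩
  rw [← ENNReal.rpow_le_rpow_iff (div_pos hr hp)]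
  calc (⨍⁻ y in cube x τ, g y ^ p ∂volume) ^ (r / p)
      ≤ K * w * ⨅ (s : ℝ) (_ : τ < s), ENNReal.ofReal (φ₁ x s ^ r * s ^ ((n : ℝ) * r / p)) := by
        rw [iInf_subtype', ENNReal.mul_iInf' (absurd · hKw) fun _ => hne]
        exact le_iInf fun s => setLAverage_cube_rpow_le hr hp hφ₁ g x hτ₀ s.2
    _ = K * ((⨅ (s : ℝ) (_ : τ < s), ENNReal.ofReal (φ₁ x s ^ r * s ^ ((n : ℝ) * r / p))) * w) := by
        ring
    _ ≤ K * (A * ENNReal.ofReal (φ₂ x t ^ r)) :=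
        mul_le_mul_right (iSup₂_le_iff.1 (hA x t ht) τ hτ) K
    _ = ((ENNReal.ofReal (φ₂ x t) * ((A ^ (1 / r) : ℝ≥0) * morreyNorm p φ₁ g)) ^ p) ^ (r / p) := by
        rw [← ENNReal.rpow_mul, mul_div_cancel₀ _ hp.ne', ENNReal.mul_rpow_of_nonneg _ _ hr.le,
          ENNReal.mul_rpow_of_nonneg _ _ hr.le, ENNReal.coe_rpow_of_nonneg _ (by positivity),
          ← ENNReal.rpow_mul, one_div_mul_cancel hr.ne', ENNReal.rpow_one,
          ENNReal.ofReal_rpow_of_nonneg (hφ₂ x t ht).le hr.le]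
        ring

end SupremalCondition

section LocalEstimates

variable {n : ℕ} {u : Rn n → ℝ≥0∞} {x₀ : Rn n} {ℓ : ℝ} {D : ℝ≥0∞}

/-- Balls through a point of `Q` that are smaller than `Q` stay in `5Q`, and the average over a
larger one is dominated by the average over a cube concentric with `Q`. -/
lemma maximalFn_le_max {x : Rn n} {a : ℝ≥0∞}
    (ha : ∀ (x c : Rn n) (ρ : ℝ), 0 < ρ → volume (cube x (5 * ρ)) ≤ a * volume (ball c ρ))
    (hD : ∀ τ, ℓ < τ → ⨍⁻ y in cube x₀ τ, u y ∂volume ≤ D) (hx : x ∈ cube x₀ ℓ) :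
    maximalFn volume u x ≤ max (maximalFn volume ((cube x₀ (5 * ℓ)).indicator u) x) (a * D) := by
  refine maximalFn_le_iff.2 fun c ρ hxc => ?_
  have hρ : 0 < ρ := pos_of_mem_ball hxc
  have hsub : ball c ρ ⊆ cube x₀ (4 * ρ + ℓ) := ball_subset_cube hx hxc
  rcases le_total ρ ℓ with hρℓ | hℓρ
  · refine le_max_of_le_left (le_trans (le_of_eq ?_) (setLAverage_ball_le_maximalFn hxc))
    refine setLAverage_congr_fun measurableSet_ball fun y hy => ?_
    exact (indicator_of_mem (cube_mono x₀ (by linarith) (hsub hy)) u).symm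
  · refine le_max_of_le_right ?_
    rw [setLAverage_eq, ENNReal.div_le_iff (measure_ball_pos _ _ hρ).ne' measure_ball_lt_top.ne]
    calc ∫⁻ y in ball c ρ, u y
        ≤ ∫⁻ y in cube x₀ (5 * ρ), u y :=
          lintegral_mono_set (hsub.trans (cube_mono x₀ (by linarith)))
      _ = volume (cube x₀ (5 * ρ)) * ⨍⁻ y in cube x₀ (5 * ρ), u y ∂volume :=
          (measure_mul_setLAverage u (volume_cube_ne_top x₀ (by positivity))).symm
      _ ≤ a * volume (ball c ρ) * D := by
          gcongr
          · exact ha x₀ c ρ hρ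
          · exact hD _ (by linarith)
      _ = a * D * volume (ball c ρ) := mul_right_comm _ _ _

lemma setLIntegral_cube_five_mul_le (hℓ : 0 < ℓ)
    (hD : ∀ τ, ℓ < τ → ⨍⁻ y in cube x₀ τ, u y ∂volume ≤ D) :
    ∫⁻ y in cube x₀ (5 * ℓ), u y ≤ 5 ^ n * volume (cube x₀ ℓ) * D := by
  rw [← measure_mul_setLAverage u (volume_cube_ne_top x₀ (by positivity : 0 ≤ 5 * ℓ)),
    volume_cube_five_mul x₀ hℓ.le]
  exact mul_le_mul_right (hD _ (by linarith)) _

lemma rpow_laverage_le_laverage_rpow {α : Type*} [MeasurableSpace α] (ν : Measure α) {q : ℝ}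
    (hq : 1 ≤ q) {u : α → ℝ≥0∞} (hu : Measurable u) :
    (⨍⁻ y, u y ∂ν) ^ q ≤ ⨍⁻ y, u y ^ q ∂ν := by
  have hmass : (⨍⁻ _, 1 ∂ν) ^ (q - 1) ≤ 1 :=
    ENNReal.rpow_le_one (laverage_const_le ν 1) (by linarith)
  calc (⨍⁻ y, u y ∂ν) ^ q ≤ (⨍⁻ _, 1 ∂ν) ^ (q - 1) * ⨍⁻ y, u y ^ q ∂ν := by
        simpa only [laverage, mul_one] using
          rpow_lintegral_mul_le (μ := (ν univ)⁻¹ • ν) hq hu (measurable_const (a := 1))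
    _ ≤ ⨍⁻ y, u y ^ q ∂ν := mul_le_of_le_one_left' hmass

lemma exists_lintegral_maximalFn_rpow_le (n : ℕ) {q : ℝ} (hq : 1 < q) :
    ∃ K : ℝ≥0, ∀ u : Rn n → ℝ≥0∞, Measurable u →
      ∫⁻ x, maximalFn volume u x ^ q ≤ K * ∫⁻ x, u x ^ q :=
  ⟨2 ^ q * (q.toNNReal * (5 ^ n * (q - 1)⁻¹.toNNReal)), fun u hu => by
    simpa [ENNReal.ofReal, ENNReal.coe_rpow_of_nonneg _ (by linarith : 0 ≤ q)] using
      lintegral_maximalFn_rpow_le volume_ball_five_mul_le hq hu⟩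

lemma exists_setLAverage_maximalFn_rpow_le (n : ℕ) {q : ℝ} (hq : 1 < q) :
    ∃ C : ℝ≥0, ∀ (u : Rn n → ℝ≥0∞) (x₀ : Rn n) (ℓ : ℝ) (D : ℝ≥0∞), Measurable u → 0 < ℓ →
      (∀ τ, ℓ < τ → ⨍⁻ y in cube x₀ τ, u y ^ q ∂volume ≤ D ^ q) →
        ⨍⁻ y in cube x₀ ℓ, maximalFn volume u y ^ q ∂volume ≤ C * D ^ q := by
  have hq₀ : 0 < q := by linarith
  obtain ⟨a, ha⟩ := exists_volume_cube_five_mul_le_volume_ball n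
  obtain ⟨K, hK⟩ := exists_lintegral_maximalFn_rpow_le n hq
  refine ⟨K * 5 ^ n + a ^ q, fun u x₀ ℓ D hu hℓ hD => ?_⟩
  set v := (cube x₀ (5 * ℓ)).indicator u with hv
  have hvm : Measurable v := hu.indicator (measurableSet_cube _ _)
  have hvq : ∫⁻ y, v y ^ q ≤ 5 ^ n * volume (cube x₀ ℓ) * D ^ q := by
    have hpow : ∀ y, v y ^ q = (cube x₀ (5 * ℓ)).indicator (fun y => u y ^ q) y := fun y => by
      by_cases hy : y ∈ cube x₀ (5 * ℓ) <;> simp [hv, hy, hq₀]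
    simp_rw [hpow]
    rw [lintegral_indicator (measurableSet_cube _ _)]
    exact setLIntegral_cube_five_mul_le hℓ hD
  have hDu : ∀ τ, ℓ < τ → ⨍⁻ y in cube x₀ τ, u y ∂volume ≤ D := fun τ hτ =>
    (ENNReal.rpow_le_rpow_iff hq₀).1
      ((rpow_laverage_le_laverage_rpow _ hq.le hu).trans (hD τ hτ))
  rw [setLAverage_eq, ENNReal.div_le_iff (volume_cube_ne_zero _ hℓ) (volume_cube_ne_top _ hℓ.le)]
  calc ∫⁻ y in cube x₀ ℓ, maximalFn volume u y ^ q
      ≤ ∫⁻ y in cube x₀ ℓ, (maximalFn volume v y ^ q + (a * D) ^ q) := by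
        refine setLIntegral_mono' (measurableSet_cube _ _) fun y hy => ?_
        refine (ENNReal.rpow_le_rpow (maximalFn_le_max ha hDu hy) hq₀.le).trans ?_
        rw [(ENNReal.monotone_rpow_of_nonneg hq₀.le).map_max]
        exact max_le_add_of_nonneg zero_le zero_le
    _ ≤ K * (5 ^ n * volume (cube x₀ ℓ) * D ^ q) + (a * D) ^ q * volume (cube x₀ ℓ) := by
        rw [lintegral_add_right _ measurable_const, setLIntegral_const]
        refine add_le_add_left ((setLIntegral_le_lintegral _ _).trans ?_) _
        exact (hK v hvm).trans (mul_le_mul_right hvq _)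
    _ = (K * 5 ^ n + a ^ q : ℝ≥0) * D ^ q * volume (cube x₀ ℓ) := by
        rw [ENNReal.mul_rpow_of_nonneg _ _ hq₀.le, ENNReal.coe_add, ENNReal.coe_mul,
          ENNReal.coe_rpow_of_nonneg _ hq₀.le]
        push_cast
        ring

lemma exists_mul_volume_lt_maximalFn_inter_cube_le (n : ℕ) :
    ∃ C : ℝ≥0, ∀ (u : Rn n → ℝ≥0∞) (x₀ : Rn n) (ℓ : ℝ) (D : ℝ≥0∞), 0 < ℓ →
      (∀ τ, ℓ < τ → ⨍⁻ y in cube x₀ τ, u y ∂volume ≤ D) → ∀ T,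
        T * volume ({y | T < maximalFn volume u y} ∩ cube x₀ ℓ) ≤
          C * D * volume (cube x₀ ℓ) := by
  obtain ⟨a, ha⟩ := exists_volume_cube_five_mul_le_volume_ball n
  refine ⟨a + 5 ^ n * 5 ^ n, fun u x₀ ℓ D hℓ hD T => ?_⟩
  push_cast
  rw [add_mul, add_mul]
  rcases le_or_gt T (a * D) with hT | hT
  · exact (mul_le_mul' hT (measure_mono inter_subset_right)).trans le_self_add
  set v := (cube x₀ (5 * ℓ)).indicator u
  have hsub : {y | T < maximalFn volume u y} ∩ cube x₀ ℓ ⊆ {y | T < maximalFn volume v y} :=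
    fun y ⟨hyT, hy⟩ =>
      (lt_max_iff.1 (hyT.trans_le (maximalFn_le_max ha hD hy))).resolve_right hT.not_gt
  calc T * volume ({y | T < maximalFn volume u y} ∩ cube x₀ ℓ)
      ≤ T * volume {y | T < maximalFn volume v y} := mul_le_mul_right (measure_mono hsub) T
    _ ≤ 5 ^ n * ∫⁻ y, v y := by
        exact mul_measure_lt_maximalFn_le volume_ball_five_mul_le v T
    _ ≤ 5 ^ n * (5 ^ n * volume (cube x₀ ℓ) * D) := by
        rw [lintegral_indicator (measurableSet_cube _ _)]
        exact mul_le_mul_right (setLIntegral_cube_five_mul_le hℓ hD) _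
    _ = 5 ^ n * 5 ^ n * D * volume (cube x₀ ℓ) := by ring
    _ ≤ _ := le_add_self

end LocalEstimates

namespace SupremalCondition

variable {n : ℕ} {p r : ℝ} {φ₁ φ₂ : Rn n → ℝ → ℝ}

theorem exists_morreyNorm_maximalFn_le (hr : 0 < r) (hrp : r < p)
    (hφ₁ : ∀ x t, 0 < t → 0 < φ₁ x t) (hφ₂ : ∀ x t, 0 < t → 0 < φ₂ x t)
    (h : SupremalCondition p r φ₁ φ₂) :
    ∃ C : ℝ≥0, ∀ g : Rn n → ℝ≥0∞, Measurable g → morreyNorm p φ₁ g ≠ ∞ →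
      morreyNorm p φ₂ (fun x => maximalFn volume (fun y => g y ^ r) x ^ (1 / r)) ≤
        C * morreyNorm p φ₁ g := by
  have hp : 0 < p := hr.trans hrp
  have hq : 1 < p / r := (one_lt_div hr).2 hrp
  obtain ⟨A, hA⟩ := h.exists_setLAverage_cube_le hr hp hφ₁ hφ₂
  obtain ⟨C, hC⟩ := exists_setLAverage_maximalFn_rpow_le n hq
  refine ⟨C ^ (1 / p) * A, fun g hgm hg => (morreyNorm_le_iff hp hφ₂).2 fun x₀ ℓ hℓ => ?_⟩
  set D := ENNReal.ofReal (φ₂ x₀ ℓ) * (A * morreyNorm p φ₁ g) with hD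
  have hpow : ∀ a : ℝ≥0∞, (a ^ r) ^ (p / r) = a ^ p := fun a => by
    rw [← ENNReal.rpow_mul, mul_div_cancel₀ _ hr.ne']
  calc ⨍⁻ y in cube x₀ ℓ, (maximalFn volume (fun y => g y ^ r) y ^ (1 / r)) ^ p ∂volume
      = ⨍⁻ y in cube x₀ ℓ, maximalFn volume (fun y => g y ^ r) y ^ (p / r) ∂volume := by
        simp only [← ENNReal.rpow_mul, one_div_mul_eq_div]
    _ ≤ C * (D ^ r) ^ (p / r) := by
        refine hC _ x₀ ℓ _ (hgm.pow_const r) hℓ fun τ hτ => ?_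
        simpa only [hpow] using hA g hg x₀ ℓ τ hℓ hτ
    _ = (C ^ (1 / p) * D) ^ p := by
        rw [hpow, ENNReal.mul_rpow_of_nonneg _ D hp.le, ← ENNReal.rpow_mul,
          one_div_mul_cancel hp.ne', ENNReal.rpow_one]
    _ = (ENNReal.ofReal (φ₂ x₀ ℓ) * ((C ^ (1 / p) * A : ℝ≥0) * morreyNorm p φ₁ g)) ^ p := by
        rw [hD, ENNReal.coe_mul, ENNReal.coe_rpow_of_nonneg _ (by positivity)]
        ring_nf

theorem exists_weakMorreyNorm_maximalFn_le (hr : 0 < r) (hφ₁ : ∀ x t, 0 < t → 0 < φ₁ x t)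
    (hφ₂ : ∀ x t, 0 < t → 0 < φ₂ x t) (h : SupremalCondition r r φ₁ φ₂) :
    ∃ C : ℝ≥0, ∀ g : Rn n → ℝ≥0∞, morreyNorm r φ₁ g ≠ ∞ →
      weakMorreyNorm r φ₂ (fun x => maximalFn volume (fun y => g y ^ r) x ^ (1 / r)) ≤
        C * morreyNorm r φ₁ g := by
  obtain ⟨A, hA⟩ := h.exists_setLAverage_cube_le hr hr hφ₁ hφ₂
  obtain ⟨C, hC⟩ := exists_mul_volume_lt_maximalFn_inter_cube_le n
  refine ⟨C ^ (1 / r) * A, fun g hg => weakMorreyNorm_le hr hφ₂ fun T x₀ ℓ _ hℓ => ?_⟩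
  set D := ENNReal.ofReal (φ₂ x₀ ℓ) * (A * morreyNorm r φ₁ g) with hD
  simp only [one_div, ENNReal.lt_rpow_inv_iff hr]
  refine (hC _ x₀ ℓ (D ^ r) hℓ (fun τ hτ => hA g hg x₀ ℓ τ hℓ hτ) _).trans_eq ?_
  have hconst : ENNReal.ofReal (φ₂ x₀ ℓ) * ((C ^ r⁻¹ * A : ℝ≥0) * morreyNorm r φ₁ g) =
      C ^ r⁻¹ * D := by
    rw [hD, ENNReal.coe_mul, ENNReal.coe_rpow_of_nonneg _ (by positivity)]
    ring
  rw [hconst, ENNReal.mul_rpow_of_nonneg _ D hr.le, ENNReal.rpow_inv_rpow hr.ne']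

end SupremalCondition

lemma exists_two_add_mul_rpow_le {a d : ℝ} (ha : 0 ≤ a) (hd : 0 ≤ d) :
    ∃ C : ℝ≥0, 0 < C ∧ ∀ s : ℝ, 0 ≤ s → (2 + d * s) ^ a ≤ C * (1 + d * s ^ a) := by
  have hC : 0 < (2 + d) ^ a * (1 + d⁻¹) := by positivity
  refine ⟨⟨_, hC.le⟩, hC, fun s hs => ?_⟩
  change _ ≤ (2 + d) ^ a * (1 + d⁻¹) * (1 + d * s ^ a)
  rw [mul_assoc]
  have hds : 0 ≤ d * s ^ a := by positivity
  have hinv : 0 ≤ d⁻¹ := inv_nonneg.2 hd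
  rcases le_or_gt (d * s) d with hle | hlt
  · calc (2 + d * s) ^ a ≤ (2 + d) ^ a := by gcongr
      _ ≤ (2 + d) ^ a * ((1 + d⁻¹) * (1 + d * s ^ a)) :=
          le_mul_of_one_le_right (by positivity) (by nlinarith)
  · have hd₀ : 0 < d := hd.lt_of_ne (by rintro rfl; simp at hlt)
    have hs₁ : 1 < s := by simpa using (lt_mul_iff_one_lt_right hd₀).1 hlt
    calc (2 + d * s) ^ a ≤ ((2 + d) * s) ^ a := by
          gcongr
          linarith
      _ = (2 + d) ^ a * (d⁻¹ * (d * s ^ a)) := by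
          rw [Real.mul_rpow (by positivity) hs, inv_mul_cancel_left₀ hd₀.ne']
      _ ≤ (2 + d) ^ a * ((1 + d⁻¹) * (1 + d * s ^ a)) := by
          gcongr <;> linarith

/-- The scale has to depend on `s` when `d = 0`, since it must be positive. -/
lemma exists_one_add_mul_rpow_le {a d : ℝ} (ha : 0 ≤ a) (hd : 0 ≤ d) :
    ∃ C : ℝ≥0, 0 < C ∧ ∀ s : ℝ, 0 ≤ s → ∃ δ : ℝ, 0 < δ ∧ d ≤ δ ∧
      (1 + δ * s) ^ a ≤ C * (1 + d * s ^ a) := by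
  obtain ⟨C, hC, hbound⟩ := exists_two_add_mul_rpow_le ha hd
  refine ⟨C, hC, fun s hs => ⟨d + (1 + s)⁻¹, by positivity, ?_, ?_⟩⟩
  · exact le_add_of_nonneg_right (by positivity)
  · have hinv : (1 + s)⁻¹ * s ≤ 1 := (inv_mul_le_one₀ (by positivity)).2 (by linarith)
    refine (Real.rpow_le_rpow (by positivity) ?_ ha).trans (hbound s hs)
    linarith [add_mul d (1 + s)⁻¹ s]

lemma exists_subset_closedBall_of_diam_le {X : Type*} [PseudoMetricSpace X] [Nonempty X]
    {Ω : Set X} (hΩ : Bornology.IsBounded Ω) {δ : ℝ} (hδ : diam Ω ≤ δ) :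
    ∃ ξ, Ω ⊆ closedBall ξ δ := by
  rcases Ω.eq_empty_or_nonempty with rfl | ⟨ξ, hξ⟩
  · exact ⟨Classical.arbitrary X, empty_subset _⟩
  · exact ⟨ξ, fun η hη => (dist_le_diam_of_mem hΩ hη hξ).trans hδ⟩

lemma exists_peetreMaximal_le (n : ℕ) {r d : ℝ} (hr : 0 < r) (hd : 0 ≤ d) :
    ∃ C : ℝ≥0, 0 < C ∧ ∀ (Ω : Set (Rn n)) (f : Rn n → ℂ), Bornology.IsBounded Ω → diam Ω ≤ d →
      IsBandLimited Ω f →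
        ∀ x, peetreMaximal d r f x ≤ C * maximalFn volume (fun y => ‖f y‖ₑ ^ r) x ^ (1 / r) := by
  obtain ⟨C₁, hC₁⟩ := IsBandLimited.exists_rpow_le_maximalFn n hr
  obtain ⟨C₂, hC₂, hscale⟩ := exists_one_add_mul_rpow_le (a := n / r) (by positivity) hd
  refine ⟨(C₁ + 1) ^ (1 / r) * C₂, by positivity, fun Ω f hΩ hΩd hf x => iSup_le fun y => ?_⟩
  obtain ⟨δ, hδ, hdδ, hδy⟩ := hscale ‖y‖ (norm_nonneg y)
  obtain ⟨ξ₀, hξ₀⟩ := exists_subset_closedBall_of_diam_le hΩ (hΩd.trans hdδ)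
  have hpoint := hC₁ δ ξ₀ Ω f hδ hξ₀ hf x (x - y)
  rw [dist_eq_norm, sub_sub_cancel_left, norm_neg] at hpoint
  set M := maximalFn volume (fun y => ‖f y‖ₑ ^ r) x
  rw [ENNReal.ofReal_div_of_pos (by positivity), ofReal_norm]
  refine ENNReal.div_le_of_le_mul ?_
  calc ‖f (x - y)‖ₑ ≤ (C₁ * (ENNReal.ofReal ((1 + δ * ‖y‖) ^ n) * M)) ^ (1 / r) := by
        rwa [one_div, ENNReal.le_rpow_inv_iff hr]
    _ = (C₁ : ℝ≥0∞) ^ (1 / r) * ENNReal.ofReal ((1 + δ * ‖y‖) ^ ((n : ℝ) / r)) * M ^ (1 / r) := by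
        rw [ENNReal.mul_rpow_of_nonneg _ _ (by positivity),
          ENNReal.mul_rpow_of_nonneg _ _ (by positivity),
          ENNReal.ofReal_rpow_of_nonneg (by positivity) (by positivity), ← Real.rpow_natCast,
          ← Real.rpow_mul (by positivity), mul_one_div, mul_assoc]
    _ ≤ ((C₁ + 1 : ℝ≥0) : ℝ≥0∞) ^ (1 / r) *
          ENNReal.ofReal (C₂ * (1 + d * ‖y‖ ^ ((n : ℝ) / r))) * M ^ (1 / r) := by
        gcongr
        exact le_self_add
    _ = _ := by
        rw [ENNReal.ofReal_mul (by positivity), ENNReal.ofReal_coe_nnreal, ENNReal.coe_mul,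
          ENNReal.coe_rpow_of_nonneg _ (by positivity)]
        ring

end GenMorrey

end

theorem mainTheorem9 (n : ℕ) (hn : 1 ≤ n) (p r : ℝ) (hr : 0 < r) (hrp : r ≤ p)
    (φ₁ φ₂ : GenMorrey.Rn n → ℝ → ℝ)
    (hφ₁ : ∀ x t, 0 < t → 0 < φ₁ x t) (hφ₂ : ∀ x t, 0 < t → 0 < φ₂ x t)
    (hφ : GenMorrey.SupremalCondition p r φ₁ φ₂) (d : ℝ) :
    ∃ C : ℝ≥0, ∀ Ω : Set (GenMorrey.Rn n), IsCompact Ω → Metric.diam Ω = d →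
      ∀ f : GenMorrey.Rn n → ℂ, GenMorrey.MemMorrey p φ₁ f → GenMorrey.IsBandLimited Ω f →
        (r < p →
          GenMorrey.morreyNorm p φ₂ (GenMorrey.peetreMaximal d r f) ≤
            C * GenMorrey.morreyNorm p φ₁ (fun x => ‖f x‖ₑ)) ∧
        (p = r →
          GenMorrey.weakMorreyNorm r φ₂ (GenMorrey.peetreMaximal d r f) ≤
            C * GenMorrey.morreyNorm r φ₁ (fun x => ‖f x‖ₑ)) := by
  rcases lt_or_ge d 0 with hd | hd
  · exact ⟨0, fun Ω _ hΩ => absurd (hΩ ▸ Metric.diam_nonneg) hd.not_ge⟩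
  obtain ⟨C₁, hC₁, hpeetre⟩ := GenMorrey.exists_peetreMaximal_le n hr hd
  rcases hrp.eq_or_lt with rfl | hlt
  · obtain ⟨C₂, hC₂⟩ := hφ.exists_weakMorreyNorm_maximalFn_le hr hφ₁ hφ₂
    refine ⟨C₁ * C₂, fun Ω hΩ hΩd f hfM hf => ⟨(absurd · (lt_irrefl r)), fun _ => ?_⟩⟩
    rw [ENNReal.coe_mul, mul_assoc]
    exact (GenMorrey.weakMorreyNorm_mono hr φ₂ (hpeetre Ω f hΩ.isBounded hΩd.le hf)).trans <|
      (GenMorrey.weakMorreyNorm_const_mul_le r φ₂ hC₁ _).trans <|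
        mul_le_mul_right (hC₂ _ hfM.2.ne) _
  · obtain ⟨C₂, hC₂⟩ := hφ.exists_morreyNorm_maximalFn_le hr hlt hφ₁ hφ₂
    refine ⟨C₁ * C₂, fun Ω hΩ hΩd f hfM hf => ⟨fun _ => ?_, (absurd · hlt.ne')⟩⟩
    rw [ENNReal.coe_mul, mul_assoc]
    exact (GenMorrey.morreyNorm_mono (hr.trans hlt) φ₂
        (hpeetre Ω f hΩ.isBounded hΩd.le hf)).trans <|
      (GenMorrey.morreyNorm_const_mul_le (hr.trans hlt) hφ₂ C₁ _).trans <|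
        mul_le_mul_right (hC₂ _ hf.1.enorm.measurable hfM.2.ne) _
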